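/- Let $H=L^2([0,1])$ with inner product $\langle x,y\rangle=\int_0^1x(t)y(t)\,dt$ and norm $\|\cdot\|$. Let $(\varepsilon_k)_{k\in\mathbb Z}$ be i.i.d. random elements of $H$ with $E\|\varepsilon_k\|^2<\infty$ and $E[\varepsilon_k]=0$, let $\Psi:H\to H$ be a bounded linear operator with $\|\Psi^{k_0}\|<1$ for some $k_0\ge 1$, and let $(Y_k)_{k\in\mathbb Z}$ be the strictly stationary and causal solution, with $E\|Y_k\|^2<\infty$, of the (mean-zero) FAR(1) equation $Y_k=\Psi(Y_{k-1})+\varepsilon_k$, $k\in\mathbb Z$. Fix $d\ge 0$. Given $Y_1,\dots,Y_n$, let $\hat C_n(x)=\frac1n\sum_{k=1}^n\langle Y_k-m_n,x\rangle(Y_k-m_n)$ be the empirical covariance operator, where either $m_n=\hat\mu_n=\frac1n\sum_{k=1}^nY_k$ for all $n$, or $m_n=0$ for all $n$ (the result holds for both versions). Let $\hat\lambda_1\ge\dots\ge\hat\lambda_d$ be the $d$ largest eigenvalues of $\hat C_n$, counted with multiplicity, and $\hat v_1,\dots,\hat v_d$ any corresponding orthonormal eigenfunctions (all depending on $n$).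 Let $\boldsymbol Y_k^e=(\langle Y_k,\hat v_1\rangle,\dots,\langle Y_k,\hat v_d\rangle)'$ be the empirical FPC score vectors. * VAR predictor: let $\hat B_n\in\mathbb R^{d\times d}$ be an ordinary least squares fit of a VAR(1) model to $\boldsymbol Y_1^e,\dots,\boldsymbol Y_n^e$, i.e. any minimizer of $\sum_{k=2}^n\|\boldsymbol Y_k^e-B\boldsymbol Y_{k-1}^e\|^2$ over $B\in\mathbb R^{d\times d}$, and put $\hat Y_{n+1}=\sum_{\ell=1}^d(\hat B_n\boldsymbol Y_n^e)_\ell\,\hat v_\ell$. * Bosq's predictor: $\tilde Y_{n+1}=\tilde\Psi_n(Y_n)$, where $$\tilde\Psi_n(x)=\frac1{n-1}\sum_{k=2}^n\sum_{\ell=1}^d\sum_{\ell'=1}^d\hat\lambda_\ell^{-1}\langle x,\hat v_\ell\rangle\langle Y_{k-1},\hat v_\ell\rangle\langle Y_k,\hat v_{\ell'}\rangle\,\hat v_{\ell'},$$ with terms having $\hat\lambda_\ell=0$ omitted. Then $$\|\hat Y_{n+1}-\tilde Y_{n+1}\|=O_P\Big(\frac1n\Big)\qquad(n\to\infty),$$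 that is, for every $\eta>0$ there is $M>0$ such that $P\big(\|\hat Y_{n+1}-\tilde Y_{n+1}\|>M/n\big)\le\eta$ for all sufficiently large $n$ (with outer probability if the eigenfunctions or the minimizer are not chosen measurably). -/

import Mathlib

open MeasureTheory ProbabilityTheory Filter

namespace FAR

/-- The real Hilbert space `L²([0,1])` with Lebesgue measure. -/
abbrev L2I : Type := Lp ℝ 2 (volume.restrict (Set.Icc (0 : ℝ) 1))

/-- `Y` is the centered FAR(1) process `Y_k = Ψ(Y_{k-1}) + ε_k`, `k ∈ ℤ`: the innovations are
i.i.d., centered and square integrable, some power of the bounded operator `Ψ` has norm less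
than one, and `Y` is a strictly stationary, causal, square integrable solution. -/
structure IsFAR1 {Ω H : Type*} [MeasurableSpace Ω] [NormedAddCommGroup H] [InnerProductSpace ℝ H]
    [MeasurableSpace H] (P : Measure Ω) (Ψ : H →L[ℝ] H) (ε Y : ℤ → Ω → H) : Prop where
  innov_memLp : ∀ k, MemLp (ε k) 2 P
  innov_centered : ∀ k, ∫ ω, ε k ω ∂P = 0
  innov_indep : iIndepFun ε P
  innov_identDistrib : ∀ k, IdentDistrib (ε k) (ε 0) P P
  exists_pow_norm_lt_one : ∃ k₀ : ℕ, 1 ≤ k₀ ∧ ‖Ψ ^ k₀‖ < 1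
  memLp : ∀ k, MemLp (Y k) 2 P
  recursion : ∀ k, ∀ᵐ ω ∂P, Y k ω = Ψ (Y (k - 1) ω) + ε k ω
  stationary : ∀ h : ℤ, IdentDistrib (fun ω (k : ℤ) => Y (k + h) ω) (fun ω (k : ℤ) => Y k ω) P P
  causal : ∃ g : (ℕ → H) → H, Measurable g ∧
    ∀ k, ∀ᵐ ω ∂P, Y k ω = g (fun j : ℕ => ε (k - j) ω)

section Estimators

variable {H : Type*} [NormedAddCommGroup H] [InnerProductSpace ℝ H]

/-- The sample mean `n⁻¹ ∑_{k=1}^n y_k`. -/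
noncomputable def sampleMean (n : ℕ) (y : ℕ → H) : H :=
  (n : ℝ)⁻¹ • ∑ k ∈ Finset.Icc 1 n, y k

/-- The empirical covariance operator with centering `m`,
`x ↦ n⁻¹ ∑_{k=1}^n ⟨y_k - m, x⟩ (y_k - m)`. -/
noncomputable def empCov (m : H) (n : ℕ) (y : ℕ → H) (x : H) : H :=
  (n : ℝ)⁻¹ • ∑ k ∈ Finset.Icc 1 n, inner ℝ (y k - m) x • (y k - m)

/-- `lam 0 ≥ lam 1 ≥ ⋯` are the `d` largest eigenvalues of `T`, counted with multiplicity, and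
`v 0, v 1, …` are corresponding orthonormal eigenvectors. -/
structure IsTopEigensystem {d : ℕ} (T : H → H) (lam : Fin d → ℝ) (v : Fin d → H) : Prop where
  orthonormal : Orthonormal ℝ v
  eigen : ∀ i, T (v i) = lam i • v i
  antitone : Antitone lam
  largest : ∀ (a : ℝ) (x : H), x ≠ 0 → T x = a • x → (∀ i, inner ℝ (v i) x = 0) →
    ∀ i, a ≤ lam i

/-- The vector of scores of `x` with respect to `v`. -/
noncomputable def scores {d : ℕ} (v : Fin d → H) (x : H) : Fin d → ℝ := fun i => inner ℝ x (v i)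

/-- Residual sum of squares of the VAR(1) fit `z_k ≈ B z_{k-1}`, `k = 2, …, n`. -/
noncomputable def rss {d : ℕ} (n : ℕ) (z : ℕ → Fin d → ℝ) (B : Matrix (Fin d) (Fin d) ℝ) : ℝ :=
  ∑ k ∈ Finset.Icc 2 n, ∑ i, (z k i - (B.mulVec (z (k - 1))) i) ^ 2

/-- `B` is an ordinary least squares estimate of the VAR(1) coefficient matrix. -/
def IsOLS {d : ℕ} (n : ℕ) (z : ℕ → Fin d → ℝ) (B : Matrix (Fin d) (Fin d) ℝ) : Prop :=
  ∀ B' : Matrix (Fin d) (Fin d) ℝ, rss n z B ≤ rss n z B'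

/-- The predictor obtained from the VAR(1) forecast `B z_n` of the score vector through the
truncated Karhunen–Loève expansion. -/
noncomputable def varPredictor {d : ℕ} (v : Fin d → H) (B : Matrix (Fin d) (Fin d) ℝ)
    (n : ℕ) (y : ℕ → H) : H :=
  ∑ i, (B.mulVec (scores v (y n))) i • v i

/-- Bosq's estimator of the autoregressive operator. -/
noncomputable def bosqOperator {d : ℕ} (lam : Fin d → ℝ) (v : Fin d → H)
    (n : ℕ) (y : ℕ → H) (x : H) : H :=
  ((n : ℝ) - 1)⁻¹ • ∑ k ∈ Finset.Icc 2 n, ∑ i, ∑ j,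
    ((lam i)⁻¹ * inner ℝ x (v i) * inner ℝ (y (k - 1)) (v i) * inner ℝ (y k) (v j)) • v j

/-- Bosq's one-step predictor. -/
noncomputable def bosqPredictor {d : ℕ} (lam : Fin d → ℝ) (v : Fin d → H)
    (n : ℕ) (y : ℕ → H) : H :=
  bosqOperator lam v n y (y n)

end Estimators

/-- `X_n = O_P(r_n)` as `n → ∞`. (`P` of a set that need not be measurable is its outer
measure, so no measurability of `X_n` is presupposed.) -/
def IsBigOP {Ω : Type*} [MeasurableSpace Ω] (P : Measure Ω) (X : ℕ → Ω → ℝ) (r : ℕ → ℝ) : Prop :=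
  ∀ η : ℝ, 0 < η → ∃ M : ℝ, 0 < M ∧
    ∀ᶠ n in atTop, P {ω | M * r n < |X n ω|} ≤ ENNReal.ofReal η

end FAR

/-! Both predictors are linear in the same scores, so the comparison is algebraic. Coordinate `j` of
the VAR predictor is `⟨y_n, w_j⟩` with `w_j = ∑ B_jl v_l`. Coordinate `j` of Bosq's predictor is
`(n-1)⁻¹ ∑ ⟨y_k, v_j⟩⟨y_{k-1}, p⟩` with `p = ∑ λ_i⁻¹⟨y_n, v_i⟩ v_i`. By the normal equations `⟨y_k,
v_j⟩` may be replaced by `⟨y_{k-1}, w_j⟩`. What results is a lagged second moment, which differs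
from `n⟨Ĉp, w_j⟩ = n⟨y_n, w_j⟩` only by the centering term `n⟨m,p⟩⟨m,w_j⟩` and the missing last
summand `⟨y_n,p⟩⟨y_n,w_j⟩`. Hence the predictors differ by `(n-1)⁻¹` times an expression that is
bounded once `‖y_n‖`, `n‖m‖²`, `‖p‖` and `‖w_j‖` are (`norm_varPredictor_sub_bosqPredictor_le`).

Markov's inequality controls `‖y_n‖` and the average of `‖y_k‖²`. It also controls `n‖m‖²`, because
partial sums have second moments of order `n` (`IsFAR1.integral_norm_sum_sq_le`). For `p` and `w_j`
it suffices that each `λ_i` is at least some `c > 0` or that `v_i` is orthogonal to the data; no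
spectral gap and no convergence of eigenfunctions is needed.

This dichotomy comes from a finite-dimensional space `V` inside the orthogonal complement of the
directions invisible to `Y_0`. Either `dim V = d`, and Courant–Fischer bounds all `λ_i` below
(`IsTopEigensystem.le_eigenvalue`), or `V` is the whole complement and contains the data almost
surely (`le_eigenvalue_or_inner_eq_zero`). Both need the empirical second moments to be coercive on
`V` with high probability (`IsFAR1.exists_eventually_le_average`). That follows from a law of large
numbers along one arithmetic progression for the `m`-dependent parts `Y_k - Ψ^m Y_{k-m}`. -/

namespace FAR

/-! ### Pathwise comparison of the two predictors. -/

section Deterministic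

variable {H : Type*} [NormedAddCommGroup H] [InnerProductSpace ℝ H]

/-- The bilinear form of the empirical covariance operator. -/
lemma inner_empCov (m : H) (n : ℕ) (y : ℕ → H) (a b : H) :
    inner ℝ (empCov m n y a) b =
      (n : ℝ)⁻¹ * ∑ k ∈ Finset.Icc 1 n, inner ℝ (y k - m) a * inner ℝ (y k - m) b := by
  simp only [empCov, real_inner_smul_left, sum_inner]

lemma inner_empCov_comm (m : H) (n : ℕ) (y : ℕ → H) (a b : H) :
    inner ℝ (empCov m n y a) b = inner ℝ a (empCov m n y b) := by
  rw [real_inner_comm b, real_inner_comm, inner_empCov, real_inner_comm, inner_empCov]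
  simp only [mul_comm]

lemma natCast_smul_sampleMean {n : ℕ} (hn : n ≠ 0) (y : ℕ → H) :
    (n : ℝ) • sampleMean n y = ∑ k ∈ Finset.Icc 1 n, y k := by
  rw [sampleMean, smul_smul, mul_inv_cancel₀ (by exact_mod_cast hn), one_smul]

/-- Second moments split into the empirical covariance and the squared centering. -/
lemma sum_inner_mul_inner {n : ℕ} (hn : n ≠ 0) (y : ℕ → H) {m : H}
    (hm : m = sampleMean n y ∨ m = 0) (a b : H) :
    ∑ k ∈ Finset.Icc 1 n, inner ℝ (y k) a * inner ℝ (y k) b =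
      n * inner ℝ (empCov m n y a) b + n * (inner ℝ m a * inner ℝ m b) := by
  have hn' : (n : ℝ) ≠ 0 := by exact_mod_cast hn
  rw [inner_empCov, mul_inv_cancel_left₀ hn']
  rcases hm with rfl | rfl
  · have key : ∀ x : H, ∑ k ∈ Finset.Icc 1 n, inner ℝ (y k) x
        = n * inner ℝ (sampleMean n y) x := fun x => by
      rw [← sum_inner, ← natCast_smul_sampleMean hn, real_inner_smul_left]
    generalize sampleMean n y = s at key
    simp only [inner_sub_left, sub_mul, mul_sub, Finset.sum_sub_distrib, ← Finset.sum_mul,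
      ← Finset.mul_sum, key, Finset.sum_const, Nat.card_Icc, Nat.add_sub_cancel, nsmul_eq_mul]
    ring
  · simp

/-- The normal equations of the least squares problem. -/
lemma IsOLS.normal_equations {d n : ℕ} {z : ℕ → Fin d → ℝ} {B : Matrix (Fin d) (Fin d) ℝ}
    (hB : IsOLS n z B) (j i : Fin d) :
    ∑ k ∈ Finset.Icc 2 n, (z k j - (B.mulVec (z (k - 1))) j) * z (k - 1) i = 0 := by
  set S := ∑ k ∈ Finset.Icc 2 n, (z k j - (B.mulVec (z (k - 1))) j) * z (k - 1) i with hS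
  set Q := ∑ k ∈ Finset.Icc 2 n, z (k - 1) i ^ 2 with hQ
  have hexp : ∀ t : ℝ, rss n z (B + Matrix.single j i t) = rss n z B - 2 * t * S + t ^ 2 * Q := by
    intro t
    simp only [rss, hS, hQ, Finset.mul_sum, ← Finset.sum_sub_distrib, ← Finset.sum_add_distrib]
    refine Finset.sum_congr rfl fun k _ => ?_
    rw [← sub_eq_zero, ← Finset.add_sum_erase _ _ (Finset.mem_univ j),
      ← Finset.add_sum_erase Finset.univ
        (fun i => (z k i - (B.mulVec (z (k - 1))) i) ^ 2) (Finset.mem_univ j)]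
    have h1 : ∀ l ∈ Finset.univ.erase j,
        (z k l - ((B + Matrix.single j i t).mulVec (z (k - 1))) l) ^ 2
          = (z k l - (B.mulVec (z (k - 1))) l) ^ 2 := by
      intro l hl
      have : l ≠ j := Finset.ne_of_mem_erase hl
      simp [Matrix.add_mulVec, Matrix.single_mulVec, this]
    rw [Finset.sum_congr rfl h1]
    simp [Matrix.add_mulVec, Matrix.single_mulVec]
    ring
  -- Minimality makes this quadratic in `t` nonnegative; its discriminant `4 * S ^ 2` must then be
  -- nonpositive.
  have h0 : ∀ t : ℝ, 0 ≤ Q * (t * t) + (-2 * S) * t + 0 := fun t => by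
    have := hB (B + Matrix.single j i t)
    rw [hexp] at this
    nlinarith
  have := discrim_le_zero h0
  rw [discrim] at this
  nlinarith

lemma sum_Icc_two_pred {n : ℕ} (hn : 1 ≤ n) (f : ℕ → ℝ) :
    ∑ k ∈ Finset.Icc 2 n, f (k - 1) = ∑ k ∈ Finset.Icc 1 n, f k - f n := by
  induction n, hn using Nat.le_induction with
  | base => simp
  | succ n hn ih =>
    rw [Finset.sum_Icc_succ_top (by omega), Finset.sum_Icc_succ_top (by omega), ih]
    simp

/-- The deterministic comparison of the two predictors. -/
lemma norm_varPredictor_sub_bosqPredictor_le {d n : ℕ} (hn : 2 ≤ n) {y : ℕ → H} {m : H}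
    (hm : m = sampleMean n y ∨ m = 0) {lam : Fin d → ℝ} {v : Fin d → H}
    (hv : Orthonormal ℝ v) (hev : ∀ i, empCov m n y (v i) = lam i • v i)
    {B : Matrix (Fin d) (Fin d) ℝ} (hB : IsOLS n (fun k => scores v (y k)) B)
    {c R : ℝ} (hc : 0 < c) (hR : 0 ≤ R)
    (hdich : ∀ i, c ≤ lam i ∨ ∀ k ∈ Finset.Icc 1 n, inner ℝ (y k) (v i) = 0)
    (hyn : ‖y n‖ ≤ R) (hmR : n * ‖m‖ ^ 2 ≤ R)
    (hsum : (n : ℝ)⁻¹ * ∑ k ∈ Finset.Icc 1 n, ‖y k‖ ^ 2 ≤ R) (hnc : 2 * R ^ 2 ≤ n * c) :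
    ‖varPredictor v B n y - bosqPredictor lam v n y‖ ≤
      2 * d * √(2 * R / c) * (R + R * (d * R / c) + R ^ 2 * (d * R / c)) * (1 / n) := by
  classical
  have hn0 : n ≠ 0 := by omega
  have hnpos : (0 : ℝ) < n := by positivity
  have hmom := sum_inner_mul_inner hn0 y hm
  have hnmem : n ∈ Finset.Icc 1 n := Finset.mem_Icc.2 ⟨by omega, le_rfl⟩
  -- Since `0⁻¹ = 0`, terms with zero eigenvalue drop out, as Bosq's estimator requires.
  set p : H := ∑ i, ((lam i)⁻¹ * inner ℝ (y n) (v i)) • v i with hp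
  have hpnorm : ‖p‖ ≤ d * R / c := by
    have : ∀ i ∈ Finset.univ, ‖((lam i)⁻¹ * inner ℝ (y n) (v i)) • v i‖ ≤ R / c := by
      intro i _
      rw [norm_smul, hv.1 i, mul_one, Real.norm_eq_abs, abs_mul]
      rcases hdich i with h | h
      · have h1 : |inner ℝ (y n) (v i)| ≤ R := by
          refine (abs_real_inner_le_norm _ _).trans ?_
          rw [hv.1 i, mul_one]; exact hyn
        have h2 : |(lam i)⁻¹| ≤ c⁻¹ := by
          rw [abs_of_pos (inv_pos.2 (hc.trans_le h))]
          exact inv_anti₀ hc h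
        calc _ ≤ c⁻¹ * R := by gcongr
          _ = R / c := by ring
      · rw [h n hnmem]; simp; positivity
    refine (norm_sum_le _ _).trans ((Finset.sum_le_sum this).trans ?_)
    simp [mul_div_assoc]
  -- Columns of `B` belonging to directions orthogonal to the data are not determined by least
  -- squares and may be huge. They never affect an in-sample fit, so they are cut off to make `w j`
  -- boundable.
  set w : Fin d → H := fun j => ∑ l, (if c ≤ lam l then B j l else 0) • v l with hw
  have hBw : ∀ j, ∀ k ∈ Finset.Icc 1 n,
      (B.mulVec (scores v (y k))) j = inner ℝ (y k) (w j) := by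
    intro j k hk
    simp only [hw, Matrix.mulVec, dotProduct, inner_sum, real_inner_smul_right, scores]
    refine Finset.sum_congr rfl fun l _ => ?_
    split_ifs with h
    · rfl
    · rw [(hdich l).resolve_left h k hk]; simp
  have hnormal : ∀ j i, ∑ k ∈ Finset.Icc 2 n,
      (inner ℝ (y k) (v j) - inner ℝ (y (k - 1)) (w j)) * inner ℝ (y (k - 1)) (v i) = 0 := by
    intro j i
    rw [← hB.normal_equations j i]
    refine Finset.sum_congr rfl fun k hk => ?_
    rw [Finset.mem_Icc] at hk
    rw [hBw j (k - 1) (Finset.mem_Icc.2 ⟨by omega, by omega⟩)]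
    rfl
  have hnormal' : ∀ j (a : Fin d → ℝ), ∑ k ∈ Finset.Icc 2 n,
      inner ℝ (y k) (v j) * inner ℝ (y (k - 1)) (∑ i, a i • v i) =
      ∑ k ∈ Finset.Icc 2 n, inner ℝ (y (k - 1)) (w j) *
        inner ℝ (y (k - 1)) (∑ i, a i • v i) := by
    intro j a
    rw [← sub_eq_zero, ← Finset.sum_sub_distrib]
    have : ∀ k ∈ Finset.Icc 2 n, inner ℝ (y k) (v j) * inner ℝ (y (k - 1)) (∑ i, a i • v i) -
        inner ℝ (y (k - 1)) (w j) * inner ℝ (y (k - 1)) (∑ i, a i • v i) =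
        ∑ i, a i * ((inner ℝ (y k) (v j) - inner ℝ (y (k - 1)) (w j)) *
          inner ℝ (y (k - 1)) (v i)) := fun k _ => by
      rw [← sub_mul, inner_sum (f := fun i => a i • v i), Finset.mul_sum]
      refine Finset.sum_congr rfl fun i _ => ?_
      rw [real_inner_smul_right]
      ring
    rw [Finset.sum_congr rfl this, Finset.sum_comm]
    refine Finset.sum_eq_zero fun i _ => ?_
    rw [← Finset.mul_sum, hnormal, mul_zero]
  have hlag : ∀ a b : H, ∑ k ∈ Finset.Icc 2 n, inner ℝ (y (k - 1)) a * inner ℝ (y (k - 1)) b =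
      n * inner ℝ (empCov m n y a) b + n * (inner ℝ m a * inner ℝ m b)
        - inner ℝ (y n) a * inner ℝ (y n) b := by
    intro a b
    rw [← hmom, ← sum_Icc_two_pred (by omega) fun k => inner ℝ (y k) a * inner ℝ (y k) b]
  have hTlin : ∀ (a : Fin d → ℝ) (x : H), inner ℝ (empCov m n y (∑ i, a i • v i)) x =
      ∑ i, a i * lam i * inner ℝ (v i) x := by
    intro a x
    rw [inner_empCov_comm, sum_inner]
    refine Finset.sum_congr rfl fun i _ => ?_
    rw [real_inner_smul_left, ← inner_empCov_comm, hev, real_inner_smul_left]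
    ring
  have hwnorm : ∀ j, ‖w j‖ ≤ √(2 * R / c) := by
    intro j
    refine Real.le_sqrt_of_sq_le ?_
    -- Fitted values are an orthogonal projection of the responses, so their sum of squares is no
    -- larger.
    have h1 : ∑ k ∈ Finset.Icc 2 n, inner ℝ (y (k - 1)) (w j) ^ 2 ≤ n * R := by
      have h2 := hnormal' j fun l => if c ≤ lam l then B j l else 0
      change ∑ k ∈ Finset.Icc 2 n, inner ℝ (y k) (v j) * inner ℝ (y (k - 1)) (w j) =
        ∑ k ∈ Finset.Icc 2 n, inner ℝ (y (k - 1)) (w j) * inner ℝ (y (k - 1)) (w j) at h2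
      have h3 : ∑ k ∈ Finset.Icc 2 n, 2 * (inner ℝ (y k) (v j) * inner ℝ (y (k - 1)) (w j)) ≤
          ∑ k ∈ Finset.Icc 2 n, (inner ℝ (y k) (v j) ^ 2 + inner ℝ (y (k - 1)) (w j) ^ 2) :=
        Finset.sum_le_sum fun k _ => by
          nlinarith [sq_nonneg (inner ℝ (y k) (v j) - inner ℝ (y (k - 1)) (w j))]
      rw [← Finset.mul_sum, h2, Finset.sum_add_distrib] at h3
      simp only [← pow_two] at h3
      have h4 : ∑ k ∈ Finset.Icc 2 n, inner ℝ (y k) (v j) ^ 2 ≤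
          ∑ k ∈ Finset.Icc 1 n, ‖y k‖ ^ 2 := by
        refine (Finset.sum_le_sum fun k _ => ?_).trans
          (Finset.sum_le_sum_of_subset_of_nonneg (Finset.Icc_subset_Icc_left one_le_two)
            fun k _ _ => by positivity)
        rw [← sq_abs]
        gcongr
        simpa [hv.1 j] using abs_real_inner_le_norm (y k) (v j)
      have h5 : ∑ k ∈ Finset.Icc 1 n, ‖y k‖ ^ 2 ≤ n * R := by
        rwa [inv_mul_le_iff₀ hnpos] at hsum
      linarith
    have h6 : c * ‖w j‖ ^ 2 ≤ inner ℝ (empCov m n y (w j)) (w j) := by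
      rw [hTlin, ← real_inner_self_eq_norm_sq]
      nth_rewrite 1 [hw]
      rw [sum_inner, Finset.mul_sum]
      refine Finset.sum_le_sum fun l _ => ?_
      have : inner ℝ (v l) (w j) = if c ≤ lam l then B j l else 0 := by
        rw [real_inner_comm]
        exact hv.inner_left_fintype _ l
      rw [real_inner_smul_left, this]
      split_ifs with h
      · nlinarith [mul_self_nonneg (B j l)]
      · simp
    have h7 := hlag (w j) (w j)
    simp only [← pow_two] at h7
    have h8 : inner ℝ (y n) (w j) ^ 2 ≤ R ^ 2 * ‖w j‖ ^ 2 := by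
      rw [← sq_abs, ← mul_pow]
      gcongr
      exact (abs_real_inner_le_norm _ _).trans (by gcongr)
    rw [le_div_iff₀ hc]
    have h9 : n * (c * ‖w j‖ ^ 2) ≤ n * inner ℝ (empCov m n y (w j)) (w j) := by gcongr
    -- The missing last observation costs at most half of the coercivity `n * c`; this is where `2 *
    -- R ^ 2 ≤ n * c` enters and the factor 2 in `√(2 * R / c)` arises.
    have h10 : R ^ 2 * ‖w j‖ ^ 2 ≤ n * c / 2 * ‖w j‖ ^ 2 := by gcongr; linarith
    have h11 : 0 ≤ n * inner ℝ m (w j) ^ 2 := by positivity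
    have h12 : n * (‖w j‖ ^ 2 * c) ≤ n * (2 * R) := by nlinarith
    exact le_of_mul_le_mul_left h12 hnpos
  -- On the retained directions `p` is `Ĉ⁻¹` applied to the projection of `y n`, and `w j` involves
  -- no others.
  have hTp : ∀ j, inner ℝ (empCov m n y p) (w j) = inner ℝ (y n) (w j) := by
    intro j
    rw [hp, hTlin]
    simp only [hw, inner_sum, real_inner_smul_right]
    refine Finset.sum_congr rfl fun l _ => ?_
    rw [Finset.sum_eq_single l]
    · rw [orthonormal_iff_ite.1 hv, if_pos rfl]
      split_ifs with h
      · have : lam l ≠ 0 := (hc.trans_le h).ne'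
        field_simp
      · simp
    · intro i _ hi
      rw [orthonormal_iff_ite.1 hv, if_neg hi.symm]
      simp
    · simp
  have hbosq : bosqPredictor lam v n y = ∑ j, (((n : ℝ) - 1)⁻¹ *
      (n * inner ℝ (y n) (w j) + n * (inner ℝ m p * inner ℝ m (w j))
        - inner ℝ (y n) p * inner ℝ (y n) (w j))) • v j := by
    have : ∀ j, n * inner ℝ (y n) (w j) + n * (inner ℝ m p * inner ℝ m (w j))
        - inner ℝ (y n) p * inner ℝ (y n) (w j) = ∑ k ∈ Finset.Icc 2 n, ∑ i,
          ((lam i)⁻¹ * inner ℝ (y n) (v i) * inner ℝ (y (k - 1)) (v i) * inner ℝ (y k) (v j)) := by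
      intro j
      rw [show (n : ℝ) * inner ℝ (y n) (w j) = n * inner ℝ (empCov m n y p) (w j) by rw [hTp],
        ← hlag]
      have := hnormal' j fun i => (lam i)⁻¹ * inner ℝ (y n) (v i)
      rw [← hp] at this
      simp only [mul_comm (inner ℝ _ p)]
      rw [← this]
      refine Finset.sum_congr rfl fun k _ => ?_
      rw [hp, inner_sum, Finset.mul_sum]
      refine Finset.sum_congr rfl fun i _ => ?_
      rw [real_inner_smul_right]
      ring
    simp only [this, bosqPredictor, bosqOperator, mul_smul ((n : ℝ) - 1)⁻¹, ← Finset.smul_sum]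
    congr 1
    simp only [Finset.sum_smul]
    symm
    rw [Finset.sum_comm]
    refine Finset.sum_congr rfl fun k _ => ?_
    exact Finset.sum_comm
  rw [hbosq, varPredictor, ← Finset.sum_sub_distrib]
  have hn1 : (0 : ℝ) < n - 1 := by
    have : (2 : ℝ) ≤ n := by exact_mod_cast hn
    linarith
  have hterm : ∀ j ∈ Finset.univ, ‖(B.mulVec (scores v (y n))) j • v j - (((n : ℝ) - 1)⁻¹ *
      (n * inner ℝ (y n) (w j) + n * (inner ℝ m p * inner ℝ m (w j))
        - inner ℝ (y n) p * inner ℝ (y n) (w j))) • v j‖ ≤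
      2 * √(2 * R / c) * (R + R * (d * R / c) + R ^ 2 * (d * R / c)) * (1 / n) := by
    intro j _
    rw [← sub_smul, norm_smul, hv.1 j, mul_one, hBw j n hnmem, Real.norm_eq_abs]
    have e1 : inner ℝ (y n) (w j) - ((n : ℝ) - 1)⁻¹ *
      (n * inner ℝ (y n) (w j) + n * (inner ℝ m p * inner ℝ m (w j))
        - inner ℝ (y n) p * inner ℝ (y n) (w j)) = ((n : ℝ) - 1)⁻¹ *
        (-inner ℝ (y n) (w j) - n * (inner ℝ m p * inner ℝ m (w j))
          + inner ℝ (y n) p * inner ℝ (y n) (w j)) := by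
      field_simp
      ring
    rw [e1, abs_mul, abs_of_pos (inv_pos.2 hn1)]
    have e2 : ((n : ℝ) - 1)⁻¹ ≤ 2 * (1 / n) := by
      rw [mul_one_div, inv_le_comm₀ hn1 (by positivity), inv_div]
      have : (2 : ℝ) ≤ n := by exact_mod_cast hn
      linarith
    have hW := hwnorm j
    have e3 : |inner ℝ (y n) (w j)| ≤ R * √(2 * R / c) :=
      (abs_real_inner_le_norm _ _).trans (by gcongr)
    have e4 : |inner ℝ (y n) p| ≤ R * (d * R / c) :=
      (abs_real_inner_le_norm _ _).trans (by gcongr)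
    have e5 : |n * (inner ℝ m p * inner ℝ m (w j))| ≤ R * (d * R / c) * √(2 * R / c) := by
      rw [abs_mul, abs_mul, abs_of_pos hnpos]
      calc _ ≤ n * ((‖m‖ * ‖p‖) * (‖m‖ * ‖w j‖)) := by
            gcongr <;> exact abs_real_inner_le_norm _ _
        _ = (n * ‖m‖ ^ 2) * ‖p‖ * ‖w j‖ := by ring
        _ ≤ _ := by gcongr
    have e6 : |-inner ℝ (y n) (w j) - n * (inner ℝ m p * inner ℝ m (w j))
          + inner ℝ (y n) p * inner ℝ (y n) (w j)| ≤ R * √(2 * R / c)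
          + R * (d * R / c) * √(2 * R / c) + R * (d * R / c) * (R * √(2 * R / c)) := by
      refine (abs_add_le _ _).trans (add_le_add ((abs_sub _ _).trans (add_le_add ?_ e5)) ?_)
      · rwa [abs_neg]
      · rw [abs_mul]; gcongr
    calc _ ≤ 2 * (1 / n) * (R * √(2 * R / c)
          + R * (d * R / c) * √(2 * R / c) + R * (d * R / c) * (R * √(2 * R / c))) := by gcongr
      _ = _ := by ring
  refine (norm_sum_le _ _).trans ((Finset.sum_le_sum hterm).trans (le_of_eq ?_))
  simp
  ring

end Deterministic

end FAR

namespace FAR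

/-! ### Lower bounds for empirical eigenvalues. -/

section Eigenvalues

variable {H : Type*} [NormedAddCommGroup H] [InnerProductSpace ℝ H]

lemma empCov_add (m : H) (n : ℕ) (y : ℕ → H) (a b : H) :
    empCov m n y (a + b) = empCov m n y a + empCov m n y b := by
  simp only [empCov, inner_add_right, add_smul, Finset.sum_add_distrib, smul_add]

lemma empCov_smul (m : H) (n : ℕ) (y : ℕ → H) (t : ℝ) (a : H) :
    empCov m n y (t • a) = t • empCov m n y a := by
  rw [empCov, empCov, smul_comm t ((n : ℝ)⁻¹), Finset.smul_sum (r := t)]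
  simp only [real_inner_smul_right, mul_smul]

lemma empCov_mem {m : H} {n : ℕ} {y : ℕ → H} {V : Submodule ℝ H}
    (h : ∀ k ∈ Finset.Icc 1 n, y k - m ∈ V) (a : H) : empCov m n y a ∈ V :=
  V.smul_mem _ (V.sum_mem fun k hk => V.smul_mem _ (h k hk))

/-- If the data lie in a subspace on which the empirical covariance is bounded below by `c`, then
an eigenvector has an eigenvalue at least `c` or is orthogonal to the data. -/
lemma le_eigenvalue_or_inner_eq_zero {n : ℕ} {y : ℕ → H} {m : H}
    (hm : m = sampleMean n y ∨ m = 0) (V : Submodule ℝ H) [FiniteDimensional ℝ V]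
    (hyV : ∀ k ∈ Finset.Icc 1 n, y k ∈ V) {c : ℝ} (hc : 0 < c)
    (hV : ∀ x ∈ V, c * ‖x‖ ^ 2 ≤ inner ℝ (empCov m n y x) x)
    {lam : ℝ} {v : H} (hv : ‖v‖ = 1) (hev : empCov m n y v = lam • v) :
    c ≤ lam ∨ ∀ k ∈ Finset.Icc 1 n, inner ℝ (y k) v = 0 := by
  have hmV : m ∈ V := by
    rcases hm with rfl | rfl
    · exact V.smul_mem _ (V.sum_mem hyV)
    · exact V.zero_mem
  have hsub : ∀ k ∈ Finset.Icc 1 n, y k - m ∈ V := fun k hk => V.sub_mem (hyV k hk) hmV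
  have hlam : inner ℝ (empCov m n y v) v = lam := by
    rw [hev, real_inner_smul_left, real_inner_self_eq_norm_sq, hv]
    simp
  by_cases h0 : lam = 0
  · right
    -- The data see only the projection of `v` to `V`. Its quadratic form equals `lam = 0`, so
    -- coercivity makes the projection vanish.
    have hp : ∀ u ∈ V, inner ℝ u (V.starProjection v) = inner ℝ u v := fun u hu => by
      rw [← V.inner_starProjection_left_eq_right, V.starProjection_eq_self_iff.2 hu]
    have h1 := hV (V.starProjection v) (V.starProjection_apply_mem v)
    have h2 : inner ℝ (empCov m n y (V.starProjection v)) (V.starProjection v) = lam := by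
      rw [← hlam, inner_empCov, inner_empCov]
      congr 1
      exact Finset.sum_congr rfl fun k hk => by rw [hp _ (hsub k hk)]
    rw [h2, h0] at h1
    have h3 : V.starProjection v = 0 := by
      have : ‖V.starProjection v‖ ^ 2 ≤ 0 := by
        by_contra! h
        nlinarith
      exact norm_eq_zero.1 (pow_eq_zero_iff two_ne_zero |>.1 (le_antisymm this (by positivity)))
    intro k hk
    rw [← hp _ (hyV k hk), h3, inner_zero_right]
  · left
    -- An eigenvector with nonzero eigenvalue lies in the range of the operator, hence in `V`.
    have hvV : v ∈ V := by
      have := V.smul_mem lam⁻¹ (empCov_mem hsub v)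
      rwa [hev, smul_smul, inv_mul_cancel₀ h0, one_smul] at this
    have := hV v hvV
    rwa [hlam, hv, one_pow, mul_one] at this

/-- Orthogonally to the top eigenvectors the Rayleigh quotient is at most each of the top
eigenvalues. -/
lemma IsTopEigensystem.inner_le {d n : ℕ} {y : ℕ → H} {m : H} {lam : Fin d → ℝ} {v : Fin d → H}
    (hv : IsTopEigensystem (empCov m n y) lam v) {u : H} (hu : ∀ i, inner ℝ (v i) u = 0)
    (i : Fin d) : inner ℝ (empCov m n y u) u ≤ lam i * ‖u‖ ^ 2 := by
  set S : Set H := (fun k => y k - m) '' (Finset.Icc 1 n : Set ℕ) with hS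
  set F : Submodule ℝ H := Submodule.span ℝ (S ∪ {u}) ⊔ Submodule.span ℝ (Set.range v) with hF
  -- A finite-dimensional invariant space containing `u` and orthogonal to the `v l`. Diagonalising
  -- there yields genuine eigenvectors, to which `largest` applies.
  set U : Submodule ℝ H := F ⊓ (Submodule.span ℝ (Set.range v))ᗮ with hU
  have : FiniteDimensional ℝ (Submodule.span ℝ (S ∪ {u})) :=
    FiniteDimensional.span_of_finite ℝ (((Finset.finite_toSet _).image _).union (Set.finite_singleton u))
  have : FiniteDimensional ℝ (Submodule.span ℝ (Set.range v)) :=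
    FiniteDimensional.span_of_finite ℝ (Set.finite_range v)
  have : FiniteDimensional ℝ U := Submodule.finiteDimensional_of_le inf_le_left
  have hperp : ∀ x : H, x ∈ (Submodule.span ℝ (Set.range v))ᗮ ↔ ∀ l, inner ℝ (v l) x = 0 := by
    intro x
    rw [Submodule.mem_orthogonal]
    refine ⟨fun h l => h _ (Submodule.subset_span ⟨l, rfl⟩), fun h w hw => ?_⟩
    induction hw using Submodule.span_induction with
    | mem w hw => obtain ⟨l, rfl⟩ := hw; exact h l
    | zero => simp
    | add a b _ _ ha hb => rw [inner_add_left, ha, hb, add_zero]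
    | smul t a _ ha => rw [real_inner_smul_left, ha, mul_zero]
  have hTU : ∀ x ∈ U, empCov m n y x ∈ U := by
    intro x hx
    refine ⟨empCov_mem (fun k hk => ?_) x, (hperp _).2 fun l => ?_⟩
    · exact Submodule.mem_sup_left (Submodule.subset_span (Or.inl ⟨k, Finset.mem_coe.2 hk, rfl⟩))
    · rw [← inner_empCov_comm, hv.eigen, real_inner_smul_left, (hperp x).1 hx.2 l, mul_zero]
  let T : U →ₗ[ℝ] U :=
    { toFun := fun x => ⟨empCov m n y x, hTU x x.2⟩
      map_add' := fun a b => Subtype.ext (empCov_add m n y a b)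
      map_smul' := fun t a => Subtype.ext (empCov_smul m n y t a) }
  have hT : T.IsSymmetric := fun a b => inner_empCov_comm m n y a b
  have huU : u ∈ U := ⟨Submodule.mem_sup_left (Submodule.subset_span (Or.inr rfl)), (hperp u).2 hu⟩
  set b := hT.eigenvectorBasis rfl with hb
  have hμ : ∀ j, hT.eigenvalues rfl j ≤ lam i := by
    intro j
    refine hv.largest _ (b j : H) ?_ ?_ ((hperp _).1 (b j).2.2) i
    · intro h
      exact b.orthonormal.ne_zero j (Subtype.ext h)
    · exact congrArg Subtype.val (hT.apply_eigenvectorBasis rfl j)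
  have h1 := b.sum_inner_mul_inner (T ⟨u, huU⟩) ⟨u, huU⟩
  have h2 := b.sum_inner_mul_inner ⟨u, huU⟩ ⟨u, huU⟩
  change _ = inner ℝ (empCov m n y u) u at h1
  rw [real_inner_self_eq_norm_sq] at h2
  change _ = ‖u‖ ^ 2 at h2
  rw [← h1, ← h2, Finset.mul_sum]
  refine Finset.sum_le_sum fun j _ => ?_
  have h3 : inner ℝ (T ⟨u, huU⟩) (b j) =
      hT.eigenvalues rfl j * inner ℝ (⟨u, huU⟩ : U) (b j) := by
    rw [hT, hb, hT.apply_eigenvectorBasis rfl j, inner_smul_right]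
    rfl
  rw [h3, real_inner_comm, mul_assoc]
  exact mul_le_mul_of_nonneg_right (hμ j) (mul_self_nonneg _)

/-- Courant–Fischer lower bound for the top `d` eigenvalues. -/
lemma IsTopEigensystem.le_eigenvalue {d n : ℕ} {y : ℕ → H} {m : H} {lam : Fin d → ℝ}
    {v : Fin d → H} (hv : IsTopEigensystem (empCov m n y) lam v)
    (V : Submodule ℝ H) [FiniteDimensional ℝ V] (hVd : Module.finrank ℝ V = d) {c : ℝ}
    (hV : ∀ x ∈ V, c * ‖x‖ ^ 2 ≤ inner ℝ (empCov m n y x) x) (i : Fin d) : c ≤ lam i := by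
  -- Fewer than `d` conditions on a `d`-dimensional space leave a nonzero `x ∈ V` orthogonal to all
  -- `v l` with `l < i`; its Rayleigh quotient lies between `c` and `lam i`.
  let L : V →ₗ[ℝ] ({l : Fin d // l < i} → ℝ) :=
    LinearMap.pi fun l => (innerSL ℝ (v l)).toLinearMap ∘ₗ V.subtype
  have hrank : Module.finrank ℝ ({l : Fin d // l < i} → ℝ) < Module.finrank ℝ V := by
    rw [Module.finrank_fintype_fun_eq_card, hVd]
    conv_rhs => rw [← Fintype.card_fin d]
    exact Fintype.card_subtype_lt (x := i) (lt_irrefl i)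
  obtain ⟨x, hxker, hx0⟩ := (Submodule.ne_bot_iff _).1 (L.ker_ne_bot_of_finrank_lt hrank)
  have hxv : ∀ l < i, inner ℝ (v l) (x : H) = 0 := fun l hl =>
    congrFun (LinearMap.mem_ker.1 hxker) ⟨l, hl⟩
  set s : H := ∑ l, inner ℝ (v l) (x : H) • v l with hs
  set u : H := x - s with hu
  have hsl : ∀ l, inner ℝ (v l) s = inner ℝ (v l) (x : H) := fun l =>
    hv.orthonormal.inner_right_fintype _ l
  have huv : ∀ l, inner ℝ (v l) u = 0 := fun l => by rw [hu, inner_sub_right, hsl, sub_self]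
  have hTs : ∀ w : H, inner ℝ (empCov m n y s) w =
      ∑ l, inner ℝ (v l) (x : H) * lam l * inner ℝ (v l) w := by
    intro w
    rw [inner_empCov_comm, hs, sum_inner]
    refine Finset.sum_congr rfl fun l _ => ?_
    rw [real_inner_smul_left, ← inner_empCov_comm, hv.eigen, real_inner_smul_left]
    ring
  have hxs : (x : H) = s + u := by rw [hu]; abel
  have h1 : inner ℝ (empCov m n y x) (x : H) =
      ∑ l, inner ℝ (v l) (x : H) * lam l * inner ℝ (v l) (x : H)
        + inner ℝ (empCov m n y u) u := by
    have e1 : inner ℝ (empCov m n y x) (x : H) = inner ℝ (empCov m n y s) (x : H) +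
        (inner ℝ (empCov m n y u) s + inner ℝ (empCov m n y u) u) := by
      rw [← inner_add_right, ← hxs, ← inner_add_left, ← empCov_add, ← hxs]
    have e2 : inner ℝ (empCov m n y u) s = 0 := by
      rw [inner_empCov_comm, real_inner_comm, hTs]
      exact Finset.sum_eq_zero fun l _ => by rw [huv, mul_zero]
    rw [e1, e2, hTs, zero_add]
  have h2 : ‖(x : H)‖ ^ 2 = ∑ l, inner ℝ (v l) (x : H) * inner ℝ (v l) (x : H) + ‖u‖ ^ 2 := by
    have e1 : inner ℝ s u = 0 := by
      rw [hs, sum_inner]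
      exact Finset.sum_eq_zero fun l _ => by rw [real_inner_smul_left, huv, mul_zero]
    have e2 : inner ℝ s s = ∑ l, inner ℝ (v l) (x : H) * inner ℝ (v l) (x : H) := by
      nth_rewrite 1 [hs]
      rw [sum_inner]
      exact Finset.sum_congr rfl fun l _ => by rw [real_inner_smul_left, hsl]
    rw [hxs, norm_add_sq_real, e1, ← real_inner_self_eq_norm_sq s, e2, ← hxs]
    ring
  have h3 : inner ℝ (empCov m n y x) (x : H) ≤ lam i * ‖(x : H)‖ ^ 2 := by
    rw [h1, h2, mul_add, Finset.mul_sum]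
    refine add_le_add (Finset.sum_le_sum fun l _ => ?_) (hv.inner_le huv i)
    rcases lt_or_ge l i with hl | hl
    · simp [hxv l hl]
    · nlinarith [hv.antitone hl, mul_self_nonneg (inner ℝ (v l) (x : H))]
  have hxpos : 0 < ‖(x : H)‖ ^ 2 := by
    have : (x : H) ≠ 0 := fun h => hx0 (Subtype.ext h)
    positivity
  exact le_of_mul_le_mul_right ((hV x x.2).trans h3) hxpos

end Eigenvalues

end FAR

namespace FAR

/-! ### Second moments and moving average structure of the process. -/

section SecondMoments

set_option linter.unusedSectionVars false

open scoped Topology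

variable {Ω : Type*} [MeasurableSpace Ω] {P : Measure Ω} [IsProbabilityMeasure P]
  {H : Type*} [NormedAddCommGroup H] [InnerProductSpace ℝ H] [CompleteSpace H]
  [SecondCountableTopology H] [MeasurableSpace H] [BorelSpace H]

lemma integrable_norm_sq_of_memLp {f : Ω → H} (hf : MemLp f 2 P) :
    Integrable (fun ω => ‖f ω‖ ^ 2) P := hf.integrable_norm_pow two_ne_zero

lemma integrable_inner_mul_inner {f : Ω → H} (hf : MemLp f 2 P) (a b : H) :
    Integrable (fun ω => inner ℝ (f ω) a * inner ℝ (f ω) b) P :=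
  (hf.inner_const a).integrable_mul (hf.inner_const b)

lemma integrable_inner_of_memLp {f g : Ω → H} (hf : MemLp f 2 P) (hg : MemLp g 2 P) :
    Integrable (fun ω => inner ℝ (f ω) (g ω)) P := by
  refine ((integrable_norm_sq_of_memLp hf).add (integrable_norm_sq_of_memLp hg)).mono'
    (hf.aestronglyMeasurable.inner hg.aestronglyMeasurable) (ae_of_all _ fun ω => ?_)
  refine (norm_inner_le_norm _ _).trans ?_
  simp only [Pi.add_apply]
  nlinarith [sq_nonneg (‖f ω‖ - ‖g ω‖), sq_nonneg ‖f ω‖, sq_nonneg ‖g ω‖]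

/-- A sum of centered independent square integrable vectors has second moment the sum of the
second moments. -/
lemma integral_norm_sum_sq_of_indep {ι : Type*} {X : ι → Ω → H} (hX : ∀ i, MemLp (X i) 2 P)
    (h0 : ∀ i, ∫ ω, X i ω ∂P = 0) (hind : Pairwise fun i j => IndepFun (X i) (X j) P)
    (s : Finset ι) :
    ∫ ω, ‖∑ i ∈ s, X i ω‖ ^ 2 ∂P = ∑ i ∈ s, ∫ ω, ‖X i ω‖ ^ 2 ∂P := by
  classical
  have hint : ∀ i j, Integrable (fun ω => inner ℝ (X i ω) (X j ω)) P := fun i j =>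
    integrable_inner_of_memLp (hX i) (hX j)
  have hij : ∀ i j, i ≠ j → ∫ ω, inner ℝ (X i ω) (X j ω) ∂P = 0 := by
    intro i j h
    have := (hind h).integral_bilin ((hX i).integrable one_le_two) ((hX j).integrable one_le_two)
      (innerSL ℝ)
    rw [h0, map_zero] at this
    exact this
  simp only [← real_inner_self_eq_norm_sq, sum_inner, inner_sum]
  rw [integral_finsetSum _ fun i _ => integrable_finsetSum _ fun j _ => hint j i]
  refine Finset.sum_congr rfl fun i hi => ?_
  rw [integral_finsetSum _ fun j _ => hint j i, Finset.sum_eq_single_of_mem i hi]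
  exact fun j _ hj => hij j i hj

variable {Ψ : H →L[ℝ] H} {ε Y : ℤ → Ω → H}

lemma IsFAR1.identDistrib (hY : IsFAR1 P Ψ ε Y) (k : ℤ) : IdentDistrib (Y k) (Y 0) P P := by
  have := (hY.stationary k).comp (measurable_pi_apply (0 : ℤ))
  simpa [Function.comp_def] using this

lemma IsFAR1.integral_norm_sq (hY : IsFAR1 P Ψ ε Y) (k : ℤ) :
    ∫ ω, ‖Y k ω‖ ^ 2 ∂P = ∫ ω, ‖Y 0 ω‖ ^ 2 ∂P :=
  ((hY.identDistrib k).comp (u := fun x : H => ‖x‖ ^ 2) (by fun_prop)).integral_eq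

lemma IsFAR1.ae_mem_of_isClosed (hY : IsFAR1 P Ψ ε Y) {s : Set H} (hs : IsClosed s)
    (h : ∀ᵐ ω ∂P, Y 0 ω ∈ s) (k : ℤ) : ∀ᵐ ω ∂P, Y k ω ∈ s :=
  (hY.identDistrib k).symm.ae_mem_snd hs.measurableSet h

/-- `1 - Ψ ^ k` is invertible by the Neumann series and factors as the geometric sum times `1 - Ψ`.
-/
lemma IsFAR1.exists_leftInverse (hY : IsFAR1 P Ψ ε Y) :
    ∃ G : H →L[ℝ] H, ∀ x, G (x - Ψ x) = x := by
  obtain ⟨k, -, hk⟩ := hY.exists_pow_norm_lt_one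
  obtain ⟨u, hu⟩ := isUnit_one_sub_of_norm_lt_one hk
  refine ⟨(↑u⁻¹ : H →L[ℝ] H) * ∑ i ∈ Finset.range k, Ψ ^ i, fun x => ?_⟩
  have h : ((↑u⁻¹ : H →L[ℝ] H) * ∑ i ∈ Finset.range k, Ψ ^ i) * (1 - Ψ) = 1 := by
    rw [mul_assoc, geom_sum_mul_neg, ← hu, Units.inv_mul]
  simpa using congrArg (fun T : H →L[ℝ] H => T x) h

lemma IsFAR1.exists_norm_pow_lt (hY : IsFAR1 P Ψ ε Y) {δ : ℝ} (hδ : 0 < δ) :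
    ∃ m : ℕ, 1 ≤ m ∧ ‖Ψ ^ m‖ < δ := by
  obtain ⟨k, hk, hk1⟩ := hY.exists_pow_norm_lt_one
  obtain ⟨j, hj⟩ := exists_pow_lt_of_lt_one hδ hk1
  refine ⟨k * (j + 1), Nat.mul_pos hk j.succ_pos, ?_⟩
  rw [pow_mul]
  refine (norm_pow_le' _ j.succ_pos).trans_lt (lt_of_le_of_lt ?_ hj)
  exact pow_le_pow_of_le_one (norm_nonneg _) hk1.le j.le_succ

/-- A pathwise bound for the partial sums of an autoregressive recursion. -/
lemma norm_sum_sq_le_of_recursion {G : H →L[ℝ] H} (hG : ∀ x, G (x - Ψ x) = x) {x e : ℤ → H}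
    (hx : ∀ k, x k = Ψ (x (k - 1)) + e k) (n : ℕ) :
    ‖∑ k ∈ Finset.Icc 1 n, x (k : ℤ)‖ ^ 2 ≤ 3 * ‖G‖ ^ 2 * ‖∑ k ∈ Finset.Icc 1 n, e (k : ℤ)‖ ^ 2
      + 3 * ‖G‖ ^ 2 * ‖Ψ‖ ^ 2 * ‖x 0‖ ^ 2 + 3 * ‖G‖ ^ 2 * ‖Ψ‖ ^ 2 * ‖x n‖ ^ 2 := by
  -- Summing the recursion telescopes up to boundary terms; `G` then recovers the partial sum.
  have h1 : ∑ k ∈ Finset.Icc 1 n, x (k : ℤ) - Ψ (∑ k ∈ Finset.Icc 1 n, x (k : ℤ)) =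
      ∑ k ∈ Finset.Icc 1 n, e (k : ℤ) + Ψ (x 0) - Ψ (x n) := by
    induction n with
    | zero => simp
    | succ n ih =>
      rw [Finset.sum_Icc_succ_top (by omega), Finset.sum_Icc_succ_top (by omega), map_add]
      have h2 := hx ((n + 1 : ℕ) : ℤ)
      rw [show ((n + 1 : ℕ) : ℤ) - 1 = n by push_cast; ring] at h2
      rw [add_sub_add_comm, ih]
      nth_rewrite 1 [h2]
      abel
  set A := ∑ k ∈ Finset.Icc 1 n, x (k : ℤ)
  set E := ∑ k ∈ Finset.Icc 1 n, e (k : ℤ)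
  have h2 : ‖A‖ ≤ ‖G‖ * (‖E‖ + ‖Ψ‖ * ‖x 0‖ + ‖Ψ‖ * ‖x n‖) := by
    rw [← hG A, h1]
    refine (G.le_opNorm _).trans ?_
    gcongr
    refine (norm_sub_le _ _).trans (add_le_add ((norm_add_le _ _).trans ?_) (Ψ.le_opNorm _))
    gcongr
    exact Ψ.le_opNorm _
  have h3 : ∀ a b c : ℝ, (a + b + c) ^ 2 ≤ 3 * (a ^ 2 + b ^ 2 + c ^ 2) := fun a b c => by
    nlinarith [sq_nonneg (a - b), sq_nonneg (a - c), sq_nonneg (b - c)]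
  calc ‖A‖ ^ 2 ≤ (‖G‖ * (‖E‖ + ‖Ψ‖ * ‖x 0‖ + ‖Ψ‖ * ‖x n‖)) ^ 2 := by gcongr
    _ = ‖G‖ ^ 2 * (‖E‖ + ‖Ψ‖ * ‖x 0‖ + ‖Ψ‖ * ‖x n‖) ^ 2 := by ring
    _ ≤ ‖G‖ ^ 2 * (3 * (‖E‖ ^ 2 + (‖Ψ‖ * ‖x 0‖) ^ 2 + (‖Ψ‖ * ‖x n‖) ^ 2)) := by
      gcongr
      exact h3 _ _ _
    _ = _ := by ring

lemma IsFAR1.integral_norm_sum_innov_sq (hY : IsFAR1 P Ψ ε Y) (n : ℕ) :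
    ∫ ω, ‖∑ k ∈ Finset.Icc 1 n, ε (k : ℤ) ω‖ ^ 2 ∂P = n * ∫ ω, ‖ε 0 ω‖ ^ 2 ∂P := by
  have hind : Pairwise fun i j : ℕ => IndepFun (ε (i : ℤ)) (ε (j : ℤ)) P := fun i j hij =>
    hY.innov_indep.indepFun (mt Int.natCast_inj.1 hij)
  rw [integral_norm_sum_sq_of_indep (X := fun k : ℕ => ε (k : ℤ))
    (fun k => hY.innov_memLp k) (fun k => hY.innov_centered k) hind]
  have : ∀ k ∈ Finset.Icc 1 n, ∫ ω, ‖ε (k : ℤ) ω‖ ^ 2 ∂P = ∫ ω, ‖ε 0 ω‖ ^ 2 ∂P := fun k _ =>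
    ((hY.innov_identDistrib k).comp (u := fun x : H => ‖x‖ ^ 2) (by fun_prop)).integral_eq
  rw [Finset.sum_congr rfl this, Finset.sum_const, Nat.card_Icc, Nat.add_sub_cancel, nsmul_eq_mul]

lemma IsFAR1.ae_norm_sum_sq_le (hY : IsFAR1 P Ψ ε Y) {G : H →L[ℝ] H}
    (hG : ∀ x, G (x - Ψ x) = x) (n : ℕ) :
    ∀ᵐ ω ∂P, ‖∑ k ∈ Finset.Icc 1 n, Y (k : ℤ) ω‖ ^ 2 ≤
      3 * ‖G‖ ^ 2 * ‖∑ k ∈ Finset.Icc 1 n, ε (k : ℤ) ω‖ ^ 2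
        + 3 * ‖G‖ ^ 2 * ‖Ψ‖ ^ 2 * ‖Y 0 ω‖ ^ 2 + 3 * ‖G‖ ^ 2 * ‖Ψ‖ ^ 2 * ‖Y n ω‖ ^ 2 := by
  have h : ∀ᵐ ω ∂P, ∀ k, Y k ω = Ψ (Y (k - 1) ω) + ε k ω := ae_all_iff.2 hY.recursion
  exact h.mono fun ω hω =>
    norm_sum_sq_le_of_recursion hG (x := fun k => Y k ω) (e := fun k => ε k ω) hω n

/-- Partial sums of a FAR(1) process have second moments of linear order. -/
lemma IsFAR1.integral_norm_sum_sq_le (hY : IsFAR1 P Ψ ε Y) :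
    ∃ C : ℝ, ∀ n : ℕ, 1 ≤ n →
      ∫ ω, ‖∑ k ∈ Finset.Icc 1 n, Y (k : ℤ) ω‖ ^ 2 ∂P ≤ C * n := by
  obtain ⟨G, hG⟩ := hY.exists_leftInverse
  obtain ⟨a, b, hb, hab⟩ : ∃ a b : ℝ, 0 ≤ b ∧ ∀ n : ℕ, ∀ᵐ ω ∂P,
      ‖∑ k ∈ Finset.Icc 1 n, Y (k : ℤ) ω‖ ^ 2 ≤
      a * ‖∑ k ∈ Finset.Icc 1 n, ε (k : ℤ) ω‖ ^ 2 + b * ‖Y 0 ω‖ ^ 2 + b * ‖Y n ω‖ ^ 2 := by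
    have hb : 0 ≤ 3 * ‖G‖ ^ 2 * ‖Ψ‖ ^ 2 := by positivity
    exact ⟨3 * ‖G‖ ^ 2, 3 * ‖G‖ ^ 2 * ‖Ψ‖ ^ 2, hb, hY.ae_norm_sum_sq_le hG⟩
  have hS0 : 0 ≤ ∫ ω, ‖Y 0 ω‖ ^ 2 ∂P := integral_nonneg fun ω => sq_nonneg _
  refine ⟨a * ∫ ω, ‖ε 0 ω‖ ^ 2 ∂P + 2 * (b * ∫ ω, ‖Y 0 ω‖ ^ 2 ∂P), fun n hn => ?_⟩
  have i0 : Integrable (fun ω => ‖∑ k ∈ Finset.Icc 1 n, Y (k : ℤ) ω‖ ^ 2) P :=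
    integrable_norm_sq_of_memLp (memLp_finsetSum _ fun k _ => hY.memLp _)
  have i1' : Integrable (fun ω => ‖∑ k ∈ Finset.Icc 1 n, ε (k : ℤ) ω‖ ^ 2) P :=
    integrable_norm_sq_of_memLp (memLp_finsetSum _ fun k _ => hY.innov_memLp _)
  have i1 := i1'.const_mul a
  have i2 : ∀ k : ℤ, Integrable (fun ω => b * ‖Y k ω‖ ^ 2) P := fun k =>
    (integrable_norm_sq_of_memLp (hY.memLp k)).const_mul _
  have i3 : Integrable (fun ω => a * ‖∑ k ∈ Finset.Icc 1 n, ε (k : ℤ) ω‖ ^ 2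
    + b * ‖Y 0 ω‖ ^ 2) P := i1.add (i2 0)
  have hle := integral_mono_ae i0 (i3.add (i2 n)) (hab n)
  have heq : ∫ ω, (a * ‖∑ k ∈ Finset.Icc 1 n, ε (k : ℤ) ω‖ ^ 2 + b * ‖Y 0 ω‖ ^ 2
      + b * ‖Y n ω‖ ^ 2) ∂P =
      a * (n * ∫ ω, ‖ε 0 ω‖ ^ 2 ∂P) + b * ∫ ω, ‖Y 0 ω‖ ^ 2 ∂P + b * ∫ ω, ‖Y 0 ω‖ ^ 2 ∂P := by
    rw [integral_add i3 (i2 n), integral_add i1 (i2 0), integral_const_mul, integral_const_mul,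
      integral_const_mul, hY.integral_norm_sum_innov_sq, hY.integral_norm_sq n]
  have hn1 : (1 : ℝ) ≤ n := by exact_mod_cast hn
  have := le_mul_of_one_le_right (mul_nonneg hb hS0) hn1
  refine hle.trans (heq.le.trans ?_)
  linarith

/-- The moving average expansion of finite order. -/
lemma IsFAR1.sub_pow_eq_sum (hY : IsFAR1 P Ψ ε Y) (k : ℤ) (m : ℕ) :
    ∀ᵐ ω ∂P, Y k ω - (Ψ ^ m) (Y (k - m) ω) =
      ∑ s ∈ Finset.Ioc (k - m) k, (Ψ ^ (k - s).toNat) (ε s ω) := by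
  filter_upwards [ae_all_iff.2 hY.recursion] with ω hω
  induction m with
  | zero => simp
  | succ m ih =>
    have h1 : Finset.Ioc (k - (m + 1 : ℕ)) k = insert (k - m) (Finset.Ioc (k - m) k) := by
      ext s
      simp only [Finset.mem_Ioc, Finset.mem_insert]
      omega
    rw [h1, Finset.sum_insert (by simp), ← ih]
    have h2 := hω (k - m)
    rw [show k - (m : ℤ) - 1 = k - (m + 1 : ℕ) by push_cast; ring] at h2
    rw [h2, show (k - (k - (m : ℤ))).toNat = m by omega, map_add, pow_succ]
    rw [show ∀ x, (Ψ ^ m * Ψ) x = (Ψ ^ m) (Ψ x) from fun _ => rfl]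
    abel

/-- Products of scores of the moving average part that are `m` time steps apart are
independent. -/
lemma IsFAR1.indepFun_inner_mul_inner (hY : IsFAR1 P Ψ ε Y) (a b : H) (m : ℕ) {k l : ℤ}
    (hkl : k + m ≤ l) :
    IndepFun
      (fun ω => inner ℝ (Y k ω - (Ψ ^ m) (Y (k - m) ω)) a *
        inner ℝ (Y k ω - (Ψ ^ m) (Y (k - m) ω)) b)
      (fun ω => inner ℝ (Y l ω - (Ψ ^ m) (Y (l - m) ω)) a *
        inner ℝ (Y l ω - (Ψ ^ m) (Y (l - m) ω)) b) P := by
  set φ : (k : ℤ) → (Finset.Ioc (k - m) k → H) → ℝ := fun k e =>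
    inner ℝ (∑ s : Finset.Ioc (k - (m : ℤ)) k, (Ψ ^ (k - (s : ℤ)).toNat) (e s)) a * inner ℝ (∑ s : Finset.Ioc (k - (m : ℤ)) k, (Ψ ^ (k - (s : ℤ)).toNat) (e s)) b
    with hφ
  have hφm : ∀ k, Measurable (φ k) := fun k => by
    have h : Continuous fun e : Finset.Ioc (k - (m : ℤ)) k → H =>
        ∑ s : Finset.Ioc (k - (m : ℤ)) k, (Ψ ^ (k - (s : ℤ)).toNat) (e s) :=
      continuous_finsetSum _ fun s _ => (Ψ ^ (k - (s : ℤ)).toNat).continuous.comp (continuous_apply s)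
    have : Continuous (φ k) := (h.inner continuous_const).mul (h.inner continuous_const)
    exact this.measurable
  -- The two products depend on innovations over disjoint time windows.
  have hdisj : Disjoint (Finset.Ioc (k - m) k) (Finset.Ioc (l - m) l) := by
    rw [Finset.disjoint_left]
    intro s hs ht
    rw [Finset.mem_Ioc] at hs ht
    omega
  have hi := (hY.innov_indep.indepFun_finset₀ _ _ hdisj
    fun k => (hY.innov_memLp k).aestronglyMeasurable.aemeasurable).comp (hφm k) (hφm l)
  have hae : ∀ k, (φ k ∘ fun ω (s : Finset.Ioc (k - m) k) => ε s ω) =ᵐ[P]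
      fun ω => inner ℝ (Y k ω - (Ψ ^ m) (Y (k - m) ω)) a *
        inner ℝ (Y k ω - (Ψ ^ m) (Y (k - m) ω)) b := by
    intro k
    filter_upwards [hY.sub_pow_eq_sum k m] with ω hω
    rw [hω, Function.comp_apply, hφ]
    simp only
    rw [Finset.sum_coe_sort (Finset.Ioc (k - m) k) fun s => (Ψ ^ (k - s).toNat) (ε s ω)]
  exact hi.congr (hae k) (hae l)

end SecondMoments

end FAR

namespace FAR

/-! ### Approximate law of large numbers along an arithmetic progression. -/

section LawOfLargeNumbers

set_option linter.unusedSectionVars false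

open scoped Topology

variable {Ω : Type*} [MeasurableSpace Ω] {P : Measure Ω} [IsProbabilityMeasure P]
  {H : Type*} [NormedAddCommGroup H] [InnerProductSpace ℝ H] [CompleteSpace H]
  [SecondCountableTopology H] [MeasurableSpace H] [BorelSpace H]
  {Ψ : H →L[ℝ] H} {ε Y : ℤ → Ω → H}

lemma abs_inner_mul_inner_sub_le {y t a b : H} (ha : ‖a‖ ≤ 1) (hb : ‖b‖ ≤ 1) :
    |inner ℝ y a * inner ℝ y b - inner ℝ (y - t) a * inner ℝ (y - t) b| ≤
      2 * ‖t‖ * ‖y‖ + ‖t‖ ^ 2 := by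
  have key : ∀ x c : H, ‖c‖ ≤ 1 → |inner ℝ x c| ≤ ‖x‖ := fun x c hc =>
    (abs_real_inner_le_norm _ _).trans (mul_le_of_le_one_right (norm_nonneg _) hc)
  have e : inner ℝ y a * inner ℝ y b - inner ℝ (y - t) a * inner ℝ (y - t) b =
      inner ℝ t a * inner ℝ y b + inner ℝ (y - t) a * inner ℝ t b := by
    simp only [inner_sub_left]
    ring
  rw [e]
  refine (abs_add_le _ _).trans ?_
  rw [abs_mul, abs_mul]
  calc _ ≤ ‖t‖ * ‖y‖ + (‖y‖ + ‖t‖) * ‖t‖ := by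
        gcongr
        · exact key _ _ ha
        · exact key _ _ hb
        · exact (key _ _ ha).trans (norm_sub_le _ _)
        · exact key _ _ hb
    _ = _ := by ring

/-- The products of scores are close in mean to those of the moving average part. -/
lemma IsFAR1.integral_abs_sub_le (hY : IsFAR1 P Ψ ε Y) {a b : H} (ha : ‖a‖ ≤ 1) (hb : ‖b‖ ≤ 1)
    (m : ℕ) (k : ℤ) :
    ∫ ω, |inner ℝ (Y k ω) a * inner ℝ (Y k ω) b -
      inner ℝ (Y k ω - (Ψ ^ m) (Y (k - m) ω)) a * inner ℝ (Y k ω - (Ψ ^ m) (Y (k - m) ω)) b| ∂P ≤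
      (2 * ‖Ψ ^ m‖ + ‖Ψ ^ m‖ ^ 2) * ∫ ω, ‖Y 0 ω‖ ^ 2 ∂P := by
  set τ := ‖Ψ ^ m‖ with hτ
  have hτ0 : 0 ≤ τ := norm_nonneg _
  have i1 := (integrable_norm_sq_of_memLp (hY.memLp k)).const_mul τ
  have i2 := (integrable_norm_sq_of_memLp (hY.memLp (k - m))).const_mul (τ + τ ^ 2)
  have hle : ∀ ω, |inner ℝ (Y k ω) a * inner ℝ (Y k ω) b -
      inner ℝ (Y k ω - (Ψ ^ m) (Y (k - m) ω)) a * inner ℝ (Y k ω - (Ψ ^ m) (Y (k - m) ω)) b| ≤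
      τ * ‖Y k ω‖ ^ 2 + (τ + τ ^ 2) * ‖Y (k - m) ω‖ ^ 2 := by
    intro ω
    refine (abs_inner_mul_inner_sub_le ha hb).trans ?_
    have h1 : ‖(Ψ ^ m) (Y (k - m) ω)‖ ≤ τ * ‖Y (k - m) ω‖ := (Ψ ^ m).le_opNorm _
    have h2 : 2 * τ * (‖Y (k - m) ω‖ * ‖Y k ω‖) ≤ τ * (‖Y (k - m) ω‖ ^ 2 + ‖Y k ω‖ ^ 2) := by
      nlinarith [mul_nonneg hτ0 (sq_nonneg (‖Y (k - m) ω‖ - ‖Y k ω‖))]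
    calc _ ≤ 2 * (τ * ‖Y (k - m) ω‖) * ‖Y k ω‖ + (τ * ‖Y (k - m) ω‖) ^ 2 := by gcongr
      _ ≤ _ := by nlinarith
  refine (integral_mono_of_nonneg (ae_of_all _ fun ω => abs_nonneg _) (i1.add i2)
    (ae_of_all _ hle)).trans ?_
  simp only [Pi.add_apply]
  rw [integral_add i1 i2, integral_const_mul, integral_const_mul, hY.integral_norm_sq k,
    hY.integral_norm_sq (k - m)]
  apply le_of_eq
  ring

/-- Along an arithmetic progression the averages of the moving average parts converge in mean. -/
lemma IsFAR1.tendsto_integral_abs_average (hY : IsFAR1 P Ψ ε Y) (a b : H) (m : ℕ) :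
    ∃ q : ℝ, q = ∫ ω, inner ℝ (Y 0 ω - (Ψ ^ m) (Y (0 - m) ω)) a *
        inner ℝ (Y 0 ω - (Ψ ^ m) (Y (0 - m) ω)) b ∂P ∧
      Tendsto (fun N : ℕ => ∫ ω, |(N : ℝ)⁻¹ * ∑ j ∈ Finset.range N,
        inner ℝ (Y ((m * j + 1 : ℕ) : ℤ) ω - (Ψ ^ m) (Y (((m * j + 1 : ℕ) : ℤ) - m) ω)) a *
        inner ℝ (Y ((m * j + 1 : ℕ) : ℤ) ω - (Ψ ^ m) (Y (((m * j + 1 : ℕ) : ℤ) - m) ω)) b - q| ∂P)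
        atTop (𝓝 0) := by
  set X : ℤ → Ω → ℝ := fun k ω => inner ℝ (Y k ω - (Ψ ^ m) (Y (k - m) ω)) a *
    inner ℝ (Y k ω - (Ψ ^ m) (Y (k - m) ω)) b with hX
  have hmem : ∀ k, MemLp (fun ω => Y k ω - (Ψ ^ m) (Y (k - m) ω)) 2 P := fun k =>
    (hY.memLp k).sub ((Ψ ^ m).comp_memLp' (hY.memLp _))
  have hint : ∀ k, Integrable (X k) P := fun k => integrable_inner_mul_inner (hmem k) a b
  have hident : ∀ k, IdentDistrib (X k) (X 0) P P := by
    intro k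
    set φ : (ℤ → H) → ℝ := fun y => inner ℝ (y 0 - (Ψ ^ m) (y (0 - m))) a *
      inner ℝ (y 0 - (Ψ ^ m) (y (0 - m))) b with hφ
    have hφm : Measurable φ := by
      have hc : Continuous fun x : H × H => inner ℝ (x.1 - (Ψ ^ m) x.2) a *
        inner ℝ (x.1 - (Ψ ^ m) x.2) b := by fun_prop
      have hp : Measurable fun y : ℤ → H => (y 0, y (0 - (m : ℤ))) :=
        (measurable_pi_apply 0).prodMk (measurable_pi_apply _)
      exact hc.measurable.comp hp
    have h := (hY.stationary k).comp hφm
    have e : X k = φ ∘ fun ω (l : ℤ) => Y (l + k) ω := by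
      funext ω
      simp only [hX, hφ, Function.comp_apply]
      rw [zero_add, show (0 : ℤ) - m + k = k - m by ring]
    rw [e]
    exact h
  have hind : Pairwise fun i j : ℕ => IndepFun (X ((m * i + 1 : ℕ) : ℤ))
      (X ((m * j + 1 : ℕ) : ℤ)) P := by
    have key : ∀ i j : ℕ, i < j → IndepFun (X ((m * i + 1 : ℕ) : ℤ))
        (X ((m * j + 1 : ℕ) : ℤ)) P := by
      intro i j hij
      refine hY.indepFun_inner_mul_inner a b m ?_
      have : m * (i + 1) ≤ m * j := Nat.mul_le_mul_left m hij
      rw [Nat.mul_succ] at this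
      exact_mod_cast (by omega : m * i + 1 + m ≤ m * j + 1)
    intro i j hij
    rcases lt_or_gt_of_ne hij with h | h
    · exact key i j h
    · exact (key j i h).symm
  have hlaw := strong_law_Lp (p := 1) le_rfl ENNReal.one_ne_top
    (fun j : ℕ => X ((m * j + 1 : ℕ) : ℤ)) (memLp_one_iff_integrable.2 (hint _)) hind
    (fun j => (hident _).trans (hident _).symm)
  refine ⟨_, rfl, ?_⟩
  -- The strong law centers at the first term, which has time index 1; stationarity moves it to 0.
  have hq : ∫ ω, X ((m * 0 + 1 : ℕ) : ℤ) ω ∂P = ∫ ω, X 0 ω ∂P := (hident _).integral_eq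
  simp only [hq] at hlaw
  have hlaw' := (ENNReal.tendsto_toReal ENNReal.zero_ne_top).comp hlaw
  refine hlaw'.congr fun N => ?_
  have hi : Integrable (fun ω => (N : ℝ)⁻¹ • (∑ i ∈ Finset.range N, X ((m * i + 1 : ℕ) : ℤ) ω)
      - ∫ ω, X 0 ω ∂P) P := by
    have hs : Integrable (fun ω => ∑ i ∈ Finset.range N, X ((m * i + 1 : ℕ) : ℤ) ω) P :=
      integrable_finsetSum _ fun i _ => hint _
    exact (hs.smul (N : ℝ)⁻¹).sub (integrable_const _)
  simp only [Function.comp_apply]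
  rw [eLpNorm_one_eq_lintegral_enorm, ← integral_norm_eq_lintegral_enorm hi.aestronglyMeasurable]
  rfl

/-- A law of large numbers, up to a small error, for products of scores along an arithmetic
progression. -/
lemma IsFAR1.eventually_integral_abs_average_le (hY : IsFAR1 P Ψ ε Y) {a b : H} (ha : ‖a‖ ≤ 1)
    (hb : ‖b‖ ≤ 1) {m : ℕ} {δ : ℝ}
    (hm : 2 * ((2 * ‖Ψ ^ m‖ + ‖Ψ ^ m‖ ^ 2) * ∫ ω, ‖Y 0 ω‖ ^ 2 ∂P) < δ) :
    ∀ᶠ N : ℕ in atTop, ∫ ω, |(N : ℝ)⁻¹ * ∑ j ∈ Finset.range N,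
      inner ℝ (Y ((m * j + 1 : ℕ) : ℤ) ω) a * inner ℝ (Y ((m * j + 1 : ℕ) : ℤ) ω) b
      - ∫ ω, inner ℝ (Y 0 ω) a * inner ℝ (Y 0 ω) b ∂P| ∂P ≤ δ := by
  obtain ⟨q, hq, hlim⟩ := hY.tendsto_integral_abs_average a b m
  have hκ := hY.integral_abs_sub_le ha hb m
  set κ := (2 * ‖Ψ ^ m‖ + ‖Ψ ^ m‖ ^ 2) * ∫ ω, ‖Y 0 ω‖ ^ 2 ∂P
  set X : ℤ → Ω → ℝ := fun k ω => inner ℝ (Y k ω) a * inner ℝ (Y k ω) b with hX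
  set X' : ℤ → Ω → ℝ := fun k ω => inner ℝ (Y k ω - (Ψ ^ m) (Y (k - m) ω)) a *
    inner ℝ (Y k ω - (Ψ ^ m) (Y (k - m) ω)) b with hX'
  have hint : ∀ k, Integrable (X k) P := fun k => integrable_inner_mul_inner (hY.memLp k) a b
  have hint' : ∀ k, Integrable (X' k) P := fun k => integrable_inner_mul_inner
    ((hY.memLp k).sub ((Ψ ^ m).comp_memLp' (hY.memLp _))) a b
  change ∀ k, ∫ ω, |X k ω - X' k ω| ∂P ≤ κ at hκ
  change q = ∫ ω, X' 0 ω ∂P at hq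
  change Tendsto (fun N : ℕ => ∫ ω, |(N : ℝ)⁻¹ * ∑ j ∈ Finset.range N,
    X' ((m * j + 1 : ℕ) : ℤ) ω - q| ∂P) atTop (𝓝 0) at hlim
  change ∀ᶠ N : ℕ in atTop, ∫ ω, |(N : ℝ)⁻¹ * ∑ j ∈ Finset.range N,
    X ((m * j + 1 : ℕ) : ℤ) ω - ∫ ω, X 0 ω ∂P| ∂P ≤ δ
  -- The truncation error `κ` is paid twice, in the mean here and in the average below; hence the
  -- factor 2 in `hm`.
  have hmean : |q - ∫ ω, X 0 ω ∂P| ≤ κ := by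
    rw [abs_sub_comm, hq, ← integral_sub (hint 0) (hint' 0)]
    exact (abs_integral_le_integral_abs).trans (hκ 0)
  filter_upwards [hlim.eventually_lt_const (sub_pos.2 hm), eventually_ge_atTop 1] with N hN hN1
  have hNpos : (0 : ℝ) < N := by exact_mod_cast hN1
  have hle : ∀ ω, |(N : ℝ)⁻¹ * ∑ j ∈ Finset.range N,
      X ((m * j + 1 : ℕ) : ℤ) ω - ∫ ω, X 0 ω ∂P| ≤
      ((N : ℝ)⁻¹ * ∑ j ∈ Finset.range N, |X ((m * j + 1 : ℕ) : ℤ) ω - X' ((m * j + 1 : ℕ) : ℤ) ω|)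
      + (|(N : ℝ)⁻¹ * ∑ j ∈ Finset.range N, X' ((m * j + 1 : ℕ) : ℤ) ω - q| + κ) := by
    intro ω
    have e : (N : ℝ)⁻¹ * ∑ j ∈ Finset.range N, X ((m * j + 1 : ℕ) : ℤ) ω - ∫ ω, X 0 ω ∂P =
        (N : ℝ)⁻¹ * ∑ j ∈ Finset.range N, (X ((m * j + 1 : ℕ) : ℤ) ω - X' ((m * j + 1 : ℕ) : ℤ) ω)
        + (((N : ℝ)⁻¹ * ∑ j ∈ Finset.range N, X' ((m * j + 1 : ℕ) : ℤ) ω - q)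
          + (q - ∫ ω, X 0 ω ∂P)) := by
      rw [Finset.sum_sub_distrib]
      ring
    rw [e]
    refine (abs_add_le _ _).trans (add_le_add ?_ ((abs_add_le _ _).trans (by gcongr)))
    rw [abs_mul, abs_of_pos (inv_pos.2 hNpos)]
    gcongr
    exact Finset.abs_sum_le_sum_abs _ _
  have i1 : Integrable (fun ω => (N : ℝ)⁻¹ * ∑ j ∈ Finset.range N,
      |X ((m * j + 1 : ℕ) : ℤ) ω - X' ((m * j + 1 : ℕ) : ℤ) ω|) P :=
    (integrable_finsetSum _ fun j _ => ((hint _).sub (hint' _)).abs).const_mul _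
  have i2 : Integrable (fun ω => |(N : ℝ)⁻¹ * ∑ j ∈ Finset.range N,
      X' ((m * j + 1 : ℕ) : ℤ) ω - q|) P :=
    (((integrable_finsetSum _ fun j _ => hint' _).const_mul _).sub (integrable_const _)).abs
  have i3 : Integrable (fun ω => |(N : ℝ)⁻¹ * ∑ j ∈ Finset.range N,
      X' ((m * j + 1 : ℕ) : ℤ) ω - q| + κ) P := i2.add (integrable_const _)
  have h1 : ∫ ω, (N : ℝ)⁻¹ * ∑ j ∈ Finset.range N,
      |X ((m * j + 1 : ℕ) : ℤ) ω - X' ((m * j + 1 : ℕ) : ℤ) ω| ∂P ≤ κ := by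
    have hd : ∀ k, Integrable (fun ω => |X k ω - X' k ω|) P := fun k =>
      ((hint k).sub (hint' k)).abs
    rw [integral_const_mul, integral_finsetSum _ fun j _ => hd _,
      inv_mul_le_iff₀ hNpos]
    refine (Finset.sum_le_sum fun j _ => hκ _).trans (le_of_eq ?_)
    simp
  refine (integral_mono_of_nonneg (ae_of_all _ fun ω => abs_nonneg _) (i1.add i3)
    (ae_of_all _ hle)).trans ?_
  have h2 := integral_add i1 i3
  have h3 := integral_add i2 (integrable_const κ)
  simp only [integral_const, probReal_univ, one_smul] at h3
  refine h2.le.trans ?_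
  rw [h3]
  linarith

end LawOfLargeNumbers

end FAR

namespace FAR

/-! ### Coercivity of empirical second moments with high probability. -/

section Coercivity

set_option linter.unusedSectionVars false

open scoped Topology

/-- A continuous, positive definite, 2-homogeneous function on a finite-dimensional space is
bounded below by a multiple of the squared norm. -/
lemma exists_pos_mul_norm_sq_le {E : Type*} [NormedAddCommGroup E] [NormedSpace ℝ E]
    [FiniteDimensional ℝ E] {f : E → ℝ} (hf : Continuous f)
    (hhom : ∀ (t : ℝ) (x : E), f (t • x) = t ^ 2 * f x) (hpos : ∀ x, x ≠ 0 → 0 < f x) :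
    ∃ c : ℝ, 0 < c ∧ ∀ x, c * ‖x‖ ^ 2 ≤ f x := by
  have hf0 : f 0 = 0 := by simpa using hhom 0 0
  have : ProperSpace E := FiniteDimensional.proper ℝ E
  rcases (Metric.sphere (0 : E) 1).eq_empty_or_nonempty with h | h
  · refine ⟨1, one_pos, fun x => ?_⟩
    have : x = 0 := by
      by_contra hx
      have hmem : ‖x‖⁻¹ • x ∈ Metric.sphere (0 : E) 1 := by
        rw [mem_sphere_zero_iff_norm, norm_smul, norm_inv, norm_norm,
          inv_mul_cancel₀ (norm_ne_zero_iff.2 hx)]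
      rw [h] at hmem
      exact hmem
    simp [this, hf0]
  · obtain ⟨x₀, hx₀, hmin⟩ := (isCompact_sphere (0 : E) 1).exists_isMinOn h hf.continuousOn
    have hx₀' : x₀ ≠ 0 := by
      rintro rfl
      simp at hx₀
    refine ⟨f x₀, hpos x₀ hx₀', fun x => ?_⟩
    rcases eq_or_ne x 0 with rfl | hx
    · simp [hf0]
    · have hn : ‖x‖ ≠ 0 := norm_ne_zero_iff.2 hx
      have hmem : ‖x‖⁻¹ • x ∈ Metric.sphere (0 : E) 1 := by
        rw [mem_sphere_zero_iff_norm, norm_smul, norm_inv, norm_norm, inv_mul_cancel₀ hn]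
      have h1 : f x₀ ≤ f (‖x‖⁻¹ • x) := hmin hmem
      rw [hhom, inv_pow] at h1
      have h2 : 0 < ‖x‖ ^ 2 := by positivity
      calc f x₀ * ‖x‖ ^ 2 ≤ (‖x‖ ^ 2)⁻¹ * f x * ‖x‖ ^ 2 := by gcongr
        _ = f x := by field_simp

/-- Only lower bounds are wanted and squares are nonnegative, so a single residue class modulo `m`
suffices and the other observations may be discarded. -/
lemma sum_range_le_sum_Icc {f : ℕ → ℝ} (hf : ∀ k, 0 ≤ f k) {m : ℕ} (hm : 1 ≤ m) (n : ℕ) :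
    ∑ j ∈ Finset.range (n / m), f (m * j + 1) ≤ ∑ k ∈ Finset.Icc 1 n, f k := by
  have hinj : Function.Injective fun j => m * j + 1 := fun i j h =>
    Nat.eq_of_mul_eq_mul_left hm (Nat.succ_injective h)
  refine (Finset.sum_map (Finset.range (n / m)) ⟨_, hinj⟩ f).symm.le.trans ?_
  refine Finset.sum_le_sum_of_subset_of_nonneg (fun k hk => ?_) fun k _ _ => hf k
  obtain ⟨j, hj, rfl⟩ := Finset.mem_map.1 hk
  rw [Finset.mem_range] at hj
  have h1 : m * (j + 1) ≤ n := (Nat.mul_le_mul_left m hj).trans (Nat.mul_div_le n m)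
  rw [Nat.mul_succ] at h1
  simp only [Function.Embedding.coeFn_mk, Finset.mem_Icc]
  omega

variable {Ω : Type*} [MeasurableSpace Ω] {P : Measure Ω} [IsProbabilityMeasure P]

/-- Markov's inequality. -/
lemma measure_lt_le_ofReal {f : Ω → ℝ} (hf : ∀ ω, 0 ≤ f ω) (hint : Integrable f P) {t η : ℝ}
    (ht : 0 < t) (h : ∫ ω, f ω ∂P ≤ t * η) : P {ω | t < f ω} ≤ ENNReal.ofReal η := by
  have h1 := mul_meas_ge_le_integral_of_nonneg (ae_of_all P hf) hint t
  have h2 : P.real {ω | t ≤ f ω} ≤ η := le_of_mul_le_mul_left (h1.trans h) ht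
  calc P {ω | t < f ω} ≤ P {ω | t ≤ f ω} := measure_mono fun ω (hω : t < f ω) => hω.le
    _ = ENNReal.ofReal (P.real {ω | t ≤ f ω}) := (ofReal_measureReal (measure_ne_top _ _)).symm
    _ ≤ _ := ENNReal.ofReal_le_ofReal h2

variable {H : Type*} [NormedAddCommGroup H] [InnerProductSpace ℝ H]

/-- Squared scores in coordinates. -/
lemma inner_sq_eq_sum {V : Submodule ℝ H} {r : ℕ} (e : OrthonormalBasis (Fin r) ℝ V) (z : H)
    (x : V) : inner ℝ z (x : H) ^ 2 = ∑ i, ∑ j, inner ℝ (e i) x * inner ℝ (e j) x *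
      (inner ℝ z (e i : H) * inner ℝ z (e j : H)) := by
  have h1 : inner ℝ z (x : H) = ∑ i, inner ℝ (e i) x * inner ℝ z (e i : H) := by
    conv_lhs => rw [← e.sum_repr' x]
    rw [Submodule.coe_sum, inner_sum]
    refine Finset.sum_congr rfl fun i _ => ?_
    rw [Submodule.coe_smul, real_inner_smul_right]
  rw [pow_two, h1, Finset.sum_mul_sum]
  exact Finset.sum_congr rfl fun i _ => Finset.sum_congr rfl fun j _ => by ring

/-- Lower bounds of averaged squared scores from entrywise approximation of second moments. -/
lemma le_average_of_entrywise {V : Submodule ℝ H} {r : ℕ} (e : OrthonormalBasis (Fin r) ℝ V)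
    {q : Fin r → Fin r → ℝ} {c δ : ℝ}
    (hq : ∀ x : V, c * ‖x‖ ^ 2 ≤ ∑ i, ∑ j, inner ℝ (e i) x * inner ℝ (e j) x * q i j)
    (hδ : r ^ 2 * δ ≤ c / 2) {N : ℕ} {u : ℕ → H}
    (hu : ∀ i j, |(N : ℝ)⁻¹ * ∑ l ∈ Finset.range N,
      inner ℝ (u l) (e i : H) * inner ℝ (u l) (e j : H) - q i j| ≤ δ) (x : V) :
    c / 2 * ‖x‖ ^ 2 ≤ (N : ℝ)⁻¹ * ∑ l ∈ Finset.range N, inner ℝ (u l) (x : H) ^ 2 := by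
  set A : Fin r → Fin r → ℝ := fun i j => (N : ℝ)⁻¹ * ∑ l ∈ Finset.range N,
      inner ℝ (u l) (e i : H) * inner ℝ (u l) (e j : H) with hA
  have havg : (N : ℝ)⁻¹ * ∑ l ∈ Finset.range N, inner ℝ (u l) (x : H) ^ 2 =
      ∑ i, ∑ j, inner ℝ (e i) x * inner ℝ (e j) x * A i j := by
    simp only [inner_sq_eq_sum e, hA, Finset.mul_sum]
    rw [Finset.sum_comm]
    refine Finset.sum_congr rfl fun i _ => ?_
    rw [Finset.sum_comm]
    refine Finset.sum_congr rfl fun j _ => Finset.sum_congr rfl fun l _ => by ring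
  have hcoord : ∀ i, |inner ℝ (e i) x| ≤ ‖x‖ := fun i => by
    simpa using abs_real_inner_le_norm (e i) x
  have hdiff : ∀ i j, inner ℝ (e i) x * inner ℝ (e j) x * q i j - ‖x‖ ^ 2 * δ ≤
      inner ℝ (e i) x * inner ℝ (e j) x * A i j := by
    intro i j
    have h1 : |inner ℝ (e i) x * inner ℝ (e j) x * (q i j - A i j)| ≤ ‖x‖ * ‖x‖ * δ := by
      rw [abs_mul, abs_mul]
      have := hu i j
      rw [abs_sub_comm] at this
      gcongr
      · exact hcoord i
      · exact hcoord j
    have h2 := le_of_abs_le h1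
    nlinarith
  have hsum : ∑ i, ∑ j, inner ℝ (e i) x * inner ℝ (e j) x * q i j - r ^ 2 * (‖x‖ ^ 2 * δ) ≤
      ∑ i, ∑ j, inner ℝ (e i) x * inner ℝ (e j) x * A i j := by
    refine le_trans (le_of_eq ?_)
      (Finset.sum_le_sum fun i _ => Finset.sum_le_sum fun j _ => hdiff i j)
    simp only [Finset.sum_sub_distrib, Finset.sum_const, Finset.card_univ, Fintype.card_fin,
      nsmul_eq_mul]
    ring
  rw [havg]
  have h1 := mul_le_mul_of_nonneg_right hδ (sq_nonneg ‖x‖)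
  have h2 := hq x
  linarith

variable [CompleteSpace H] [SecondCountableTopology H] [MeasurableSpace H] [BorelSpace H]
  {Ψ : H →L[ℝ] H} {ε Y : ℤ → Ω → H}

lemma exists_forall_abs_le_mul_lt {C δ : ℝ} (hC : 0 ≤ C) (hδ : 0 < δ) :
    ∃ τ : ℝ, 0 < τ ∧ ∀ s : ℝ, 0 ≤ s → s < τ → 2 * ((2 * s + s ^ 2) * C) < δ := by
  refine ⟨min 1 (δ / (6 * (C + 1))), by positivity, fun s hs h => ?_⟩
  have h1 : s < 1 := h.trans_le (min_le_left _ _)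
  have h2 : s < δ / (6 * (C + 1)) := h.trans_le (min_le_right _ _)
  rw [lt_div_iff₀ (by positivity)] at h2
  have h3 : s ^ 2 ≤ s := by nlinarith
  have h4 : (2 * s + s ^ 2) * C ≤ 3 * s * C := by gcongr; linarith
  nlinarith

/-- With high probability the empirical second moments are bounded below on a finite-dimensional
space on which the population second moments do not degenerate. -/
lemma IsFAR1.exists_eventually_le_average (hY : IsFAR1 P Ψ ε Y) (V : Submodule ℝ H)
    [FiniteDimensional ℝ V] (hV : ∀ x ∈ V, x ≠ 0 → 0 < ∫ ω, inner ℝ (Y 0 ω) x ^ 2 ∂P)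
    {η : ℝ} (hη : 0 < η) :
    ∃ c : ℝ, 0 < c ∧ ∀ᶠ n : ℕ in atTop,
      P {ω | ¬ ∀ x ∈ V, c * ‖x‖ ^ 2 ≤
        (n : ℝ)⁻¹ * ∑ k ∈ Finset.Icc 1 n, inner ℝ (Y (k : ℤ) ω) x ^ 2} ≤ ENNReal.ofReal η := by
  set r := Module.finrank ℝ V
  set e := stdOrthonormalBasis ℝ V
  set q : Fin r → Fin r → ℝ := fun i j =>
    ∫ ω, inner ℝ (Y 0 ω) (e i : H) * inner ℝ (Y 0 ω) (e j : H) ∂P with hqdef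
  have hform : ∀ x : V, ∫ ω, inner ℝ (Y 0 ω) (x : H) ^ 2 ∂P =
      ∑ i, ∑ j, inner ℝ (e i) x * inner ℝ (e j) x * q i j := by
    intro x
    have hi : ∀ i j, Integrable (fun ω => inner ℝ (e i) x * inner ℝ (e j) x *
        (inner ℝ (Y 0 ω) (e i : H) * inner ℝ (Y 0 ω) (e j : H))) P := fun i j =>
      (integrable_inner_mul_inner (hY.memLp 0) _ _).const_mul _
    simp only [inner_sq_eq_sum e]
    rw [integral_finsetSum _ fun i _ => integrable_finsetSum _ fun j _ => hi i j]
    refine Finset.sum_congr rfl fun i _ => ?_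
    rw [integral_finsetSum _ fun j _ => hi i j]
    exact Finset.sum_congr rfl fun j _ => integral_const_mul _ _
  obtain ⟨c, hc, hcq⟩ := exists_pos_mul_norm_sq_le
    (f := fun x : V => ∑ i, ∑ j, inner ℝ (e i) x * inner ℝ (e j) x * q i j)
    (by fun_prop)
    (fun t x => by
      simp only [real_inner_smul_right, Finset.mul_sum]
      exact Finset.sum_congr rfl fun i _ => Finset.sum_congr rfl fun j _ => by ring)
    (fun x hx => by
      rw [← hform]
      exact hV x x.2 fun h => hx (Subtype.ext h))
  -- Entrywise errors `δ` over `r ^ 2` entries consume at most half of `c`; the failure probability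
  -- `η'` is likewise shared among the entries. The `+ 1` covers `r = 0`.
  set δ := c / (2 * (r ^ 2 + 1)) with hδdef
  have hδ : 0 < δ := by positivity
  have hrδ : r ^ 2 * δ ≤ c / 2 := by
    rw [hδdef, mul_div_assoc', div_le_div_iff₀ (by positivity) (by positivity)]
    nlinarith
  set η' := η / (r ^ 2 + 1) with hη'def
  have hη' : 0 < η' := by positivity
  obtain ⟨τ, hτ, hτs⟩ := exists_forall_abs_le_mul_lt
    (integral_nonneg fun ω => sq_nonneg _ : 0 ≤ ∫ ω, ‖Y 0 ω‖ ^ 2 ∂P) (mul_pos hδ hη')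
  obtain ⟨m, hm1, hm⟩ := hY.exists_norm_pow_lt hτ
  have hmδ := hτs _ (norm_nonneg _) hm
  have hnorm : ∀ i, ‖(e i : H)‖ ≤ 1 := fun i => (e.orthonormal.1 i).le
  have hlln := eventually_all.2 fun i => eventually_all.2 fun j =>
    hY.eventually_integral_abs_average_le (hnorm i) (hnorm j) hmδ
  have hdiv : Tendsto (fun n : ℕ => n / m) atTop atTop :=
    Nat.tendsto_div_const_atTop (by omega)
  -- The factor `2 * m` is the loss from keeping `N = n / m` of `n` terms, as `n ≤ 2 * m * N`. Since
  -- `m` depends on `η`, so does the constant, which `O_P` allows.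
  refine ⟨c / 2 / (2 * m), by positivity, ?_⟩
  filter_upwards [hdiv.eventually hlln, eventually_ge_atTop m] with n hn hnm
  set N := n / m with hN
  set A : Fin r → Fin r → Ω → ℝ := fun i j ω => |(N : ℝ)⁻¹ * ∑ l ∈ Finset.range N,
    inner ℝ (Y ((m * l + 1 : ℕ) : ℤ) ω) (e i : H) *
      inner ℝ (Y ((m * l + 1 : ℕ) : ℤ) ω) (e j : H) - q i j| with hA
  have hsub : {ω | ¬ ∀ x ∈ V, c / 2 / (2 * m) * ‖x‖ ^ 2 ≤
        (n : ℝ)⁻¹ * ∑ k ∈ Finset.Icc 1 n, inner ℝ (Y (k : ℤ) ω) x ^ 2} ⊆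
      ⋃ i, ⋃ j, {ω | δ < A i j ω} := by
    intro ω hω
    by_contra hcon
    simp only [Set.mem_iUnion, Set.mem_ofPred_eq, not_exists, not_lt] at hcon
    refine hω fun x hx => ?_
    have h1 := le_average_of_entrywise e hcq hrδ
      (u := fun l => Y ((m * l + 1 : ℕ) : ℤ) ω) hcon ⟨x, hx⟩
    have h2 := sum_range_le_sum_Icc (f := fun k : ℕ => inner ℝ (Y (k : ℤ) ω) x ^ 2)
      (fun k => sq_nonneg _) hm1 n
    simp only [Submodule.coe_norm] at h1
    have hN1 : 1 ≤ N := (Nat.one_le_div_iff hm1).2 hnm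
    have hN0 : (0 : ℝ) < N := by exact_mod_cast hN1
    have hn0 : (0 : ℝ) < n := by exact_mod_cast hm1.trans hnm
    have hm0 : (0 : ℝ) < m := by exact_mod_cast hm1
    have hnN : (n : ℝ) ≤ 2 * m * N := by
      have h3 : n < m * (N + 1) := Nat.lt_mul_div_succ n hm1
      have h4 : n ≤ 2 * m * N := by nlinarith
      exact_mod_cast h4
    rw [le_inv_mul_iff₀ hN0] at h1
    rw [le_inv_mul_iff₀ hn0]
    refine le_trans ?_ (h1.trans h2)
    calc n * (c / 2 / (2 * m) * ‖x‖ ^ 2) ≤ 2 * m * N * (c / 2 / (2 * m) * ‖x‖ ^ 2) := by gcongr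
      _ = N * (c / 2 * ‖x‖ ^ 2) := by field_simp
  have hAint : ∀ i j, Integrable (A i j) P := fun i j => by
    have hs : Integrable (fun ω => ∑ l ∈ Finset.range N,
        inner ℝ (Y ((m * l + 1 : ℕ) : ℤ) ω) (e i : H) *
          inner ℝ (Y ((m * l + 1 : ℕ) : ℤ) ω) (e j : H)) P :=
      integrable_finsetSum _ fun l _ => integrable_inner_mul_inner (hY.memLp _) _ _
    exact ((hs.const_mul _).sub (integrable_const _)).abs
  have hAle : ∀ i j, P {ω | δ < A i j ω} ≤ ENNReal.ofReal η' := fun i j =>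
    measure_lt_le_ofReal (fun ω => abs_nonneg _) (hAint i j) hδ (hn i j)
  calc _ ≤ P (⋃ i, ⋃ j, {ω | δ < A i j ω}) := measure_mono hsub
    _ ≤ ∑ i : Fin r, ∑ j : Fin r, ENNReal.ofReal η' :=
      (measure_iUnion_fintype_le _ _).trans (Finset.sum_le_sum fun i _ =>
        (measure_iUnion_fintype_le _ _).trans (Finset.sum_le_sum fun j _ => hAle i j))
    _ = ENNReal.ofReal (r ^ 2 * η') := by
      simp only [Finset.sum_const, Finset.card_univ, Fintype.card_fin, nsmul_eq_mul]
      rw [ENNReal.ofReal_mul (by positivity), ENNReal.ofReal_pow (by positivity),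
        ENNReal.ofReal_natCast, pow_two, mul_assoc]
    _ ≤ ENNReal.ofReal η := by
      refine ENNReal.ofReal_le_ofReal ?_
      rw [hη'def, mul_div_assoc', div_le_iff₀ (by positivity)]
      nlinarith

end Coercivity

end FAR

namespace FAR

/-! ### Choice of the subspace and assembly of the events. -/

section Conclusion

set_option linter.unusedSectionVars false

open scoped Topology

variable {Ω : Type*} [MeasurableSpace Ω] {P : Measure Ω} [IsProbabilityMeasure P]
  {H : Type*} [NormedAddCommGroup H] [InnerProductSpace ℝ H] [CompleteSpace H]
  [SecondCountableTopology H] [MeasurableSpace H] [BorelSpace H]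
  {Ψ : H →L[ℝ] H} {ε Y : ℤ → Ω → H}

/-- The directions to which a random vector is almost surely orthogonal. -/
def nullDirections (P : Measure Ω) (X : Ω → H) : Submodule ℝ H where
  carrier := {x | ∀ᵐ ω ∂P, inner ℝ (X ω) x = 0}
  add_mem' {a b} (ha : ∀ᵐ ω ∂P, inner ℝ (X ω) a = 0) (hb : ∀ᵐ ω ∂P, inner ℝ (X ω) b = 0) := by
    filter_upwards [ha, hb] with ω h1 h2
    rw [inner_add_right, h1, h2, add_zero]
  zero_mem' := ae_of_all P fun ω => inner_zero_right _
  smul_mem' t a (ha : ∀ᵐ ω ∂P, inner ℝ (X ω) a = 0) := by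
    filter_upwards [ha] with ω h1
    rw [real_inner_smul_right, h1, mul_zero]

lemma mem_nullDirections {X : Ω → H} {x : H} :
    x ∈ nullDirections P X ↔ ∀ᵐ ω ∂P, inner ℝ (X ω) x = 0 := Iff.rfl

/-- The exceptional null set depends on the direction; by separability a countable dense set of
directions is enough. -/
lemma ae_mem_orthogonal_nullDirections (P : Measure Ω) (X : Ω → H) :
    ∀ᵐ ω ∂P, X ω ∈ (nullDirections P X)ᗮ := by
  obtain ⟨s, hs, hd⟩ := TopologicalSpace.exists_countable_dense (nullDirections P X)
  have hall : ∀ᵐ ω ∂P, ∀ w ∈ s, inner ℝ (X ω) (w : H) = 0 :=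
    (ae_ball_iff hs).2 fun w _ => w.2
  filter_upwards [hall] with ω hω
  rw [Submodule.mem_orthogonal']
  intro u hu
  have hc : IsClosed {w : nullDirections P X | inner ℝ (X ω) (w : H) = 0} :=
    isClosed_eq (by fun_prop) continuous_const
  have := hc.closure_subset_iff.2 (fun w hw => hω w hw : s ⊆ _)
  rw [hd.closure_eq] at this
  exact this (Set.mem_univ ⟨u, hu⟩)

/-- A vanishing second moment would make `x` a null direction orthogonal to itself. -/
lemma integral_inner_sq_pos {X : Ω → H} (hX : MemLp X 2 P) {x : H}
    (hx : x ∈ (nullDirections P X)ᗮ) (hx0 : x ≠ 0) : 0 < ∫ ω, inner ℝ (X ω) x ^ 2 ∂P := by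
  refine lt_of_le_of_ne (integral_nonneg fun ω => sq_nonneg _) fun h => hx0 ?_
  have hint : Integrable (fun ω => inner ℝ (X ω) x ^ 2) P := by
    simpa only [pow_two] using integrable_inner_mul_inner hX x x
  have h0 := (integral_eq_zero_iff_of_nonneg (fun ω => sq_nonneg _) hint).1 h.symm
  have hmem : x ∈ nullDirections P X := by
    rw [mem_nullDirections]
    filter_upwards [h0] with ω hω
    exact pow_eq_zero_iff two_ne_zero |>.1 hω
  exact inner_self_eq_zero.1 ((Submodule.mem_orthogonal _ _).1 hx x hmem)

/-- A subspace has a subspace of prescribed dimension, or is itself of smaller dimension. -/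
lemma exists_le_finrank_eq_or (W : Submodule ℝ H) (d : ℕ) :
    ∃ V ≤ W, FiniteDimensional ℝ V ∧ (Module.finrank ℝ V = d ∨ V = W) := by
  by_cases h : (d : Cardinal) ≤ Module.rank ℝ W
  · obtain ⟨v, hv⟩ := Module.le_rank_iff.1 h
    have hv' : LinearIndependent ℝ fun i => (v i : H) := hv.map' W.subtype W.ker_subtype
    refine ⟨Submodule.span ℝ (Set.range fun i => (v i : H)), ?_,
      FiniteDimensional.span_of_finite ℝ (Set.finite_range _), Or.inl ?_⟩
    · rw [Submodule.span_le]
      rintro _ ⟨i, rfl⟩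
      exact (v i).2
    · rw [finrank_span_eq_card hv', Fintype.card_fin]
  · refine ⟨W, le_rfl, ?_, Or.inr rfl⟩
    exact Module.rank_lt_aleph0_iff.1 ((not_le.1 h).trans Cardinal.natCast_lt_aleph0)

lemma exists_pos_mul_le {a b η : ℝ} (hη : 0 < η) :
    ∃ R : ℝ, 1 ≤ R ∧ a ≤ R * η ∧ b ≤ R * η := by
  refine ⟨max 1 (max (a / η) (b / η)), le_max_left _ _, ?_, ?_⟩
  · rw [← div_le_iff₀ hη]
    exact (le_max_left _ _).trans (le_max_right _ _)
  · rw [← div_le_iff₀ hη]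
    exact (le_max_right _ _).trans (le_max_right _ _)

lemma norm_le_norm_sampleMean {n : ℕ} {y : ℕ → H} {m : H} (hm : m = sampleMean n y ∨ m = 0) :
    ‖m‖ ≤ ‖sampleMean n y‖ := by
  rcases hm with rfl | rfl
  · exact le_rfl
  · simp

/-- A lower bound for second moments turns into one for the empirical covariance. -/
lemma le_inner_empCov {n : ℕ} (hn : n ≠ 0) {y : ℕ → H} {m : H}
    (hm : m = sampleMean n y ∨ m = 0) {c : ℝ} {x : H}
    (hx : c * ‖x‖ ^ 2 ≤ (n : ℝ)⁻¹ * ∑ k ∈ Finset.Icc 1 n, inner ℝ (y k) x ^ 2)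
    (hmc : ‖m‖ ^ 2 ≤ c / 2) : c / 2 * ‖x‖ ^ 2 ≤ inner ℝ (empCov m n y x) x := by
  have hn' : (n : ℝ) ≠ 0 := by exact_mod_cast hn
  simp only [pow_two (inner ℝ _ x)] at hx
  rw [sum_inner_mul_inner hn y hm, ← mul_add, inv_mul_cancel_left₀ hn', ← pow_two] at hx
  have h1 : inner ℝ m x ^ 2 ≤ ‖m‖ ^ 2 * ‖x‖ ^ 2 := by
    rw [← sq_abs, ← mul_pow]
    gcongr
    exact abs_real_inner_le_norm _ _
  have h2 := mul_le_mul_of_nonneg_right hmc (sq_nonneg ‖x‖)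
  linarith

/-- The predictors agree up to `O_P(1 / n)`, in a separable Hilbert space. -/
theorem IsFAR1.isBigOP_varPredictor_sub_bosqPredictor (hY : IsFAR1 P Ψ ε Y) {y : Ω → ℕ → H}
    (hy : ∀ ω k, y ω k = Y (k : ℤ) ω) {c : ℕ → (ℕ → H) → H} (hc : c = sampleMean ∨ c = 0)
    {d : ℕ} {lam : ℕ → Ω → Fin d → ℝ} {v : ℕ → Ω → Fin d → H}
    (hv : ∀ n ω, IsTopEigensystem (empCov (c n (y ω)) n (y ω)) (lam n ω) (v n ω))
    {B : ℕ → Ω → Matrix (Fin d) (Fin d) ℝ}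
    (hB : ∀ n ω, IsOLS n (fun k => scores (v n ω) (y ω k)) (B n ω)) :
    IsBigOP P (fun n ω => ‖varPredictor (v n ω) (B n ω) n (y ω)
      - bosqPredictor (lam n ω) (v n ω) n (y ω)‖) (fun n => 1 / (n : ℝ)) := by
  intro η hη
  have hη4 : 0 < η / 4 := by positivity
  have hm : ∀ n ω, c n (y ω) = sampleMean n (y ω) ∨ c n (y ω) = 0 := by
    intro n ω
    rcases hc with rfl | rfl
    · exact Or.inl rfl
    · exact Or.inr rfl
  have hyY : ∀ ω, y ω = fun k : ℕ => Y (k : ℤ) ω := fun ω => funext (hy ω)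
  obtain ⟨V, hVW, hVfin, hVdim⟩ := exists_le_finrank_eq_or (nullDirections P (Y 0))ᗮ d
  have hYV : V = (nullDirections P (Y 0))ᗮ → ∀ᵐ ω ∂P, ∀ k : ℕ, y ω k ∈ V := by
    intro h
    have hcl : IsClosed (V : Set H) := V.closed_of_finiteDimensional
    have h0 : ∀ᵐ ω ∂P, Y 0 ω ∈ (V : Set H) := by
      rw [h]
      exact ae_mem_orthogonal_nullDirections P (Y 0)
    refine ae_all_iff.2 fun k => ?_
    filter_upwards [hY.ae_mem_of_isClosed hcl h0 k] with ω hω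
    rw [hy]
    exact hω
  have hdata : ∀ᵐ ω ∂P, Module.finrank ℝ V = d ∨ ∀ k : ℕ, y ω k ∈ V := by
    rcases hVdim with h | h
    · exact ae_of_all _ fun ω => Or.inl h
    · exact (hYV h).mono fun ω hω => Or.inr hω
  obtain ⟨c₀, hc₀, hcoer⟩ := hY.exists_eventually_le_average V
    (fun x hx hx0 => integral_inner_sq_pos (hY.memLp 0) (hVW hx) hx0) hη4
  obtain ⟨C, hC⟩ := hY.integral_norm_sum_sq_le
  obtain ⟨R, hR1, hRS, hRC⟩ := exists_pos_mul_le (a := ∫ ω, ‖Y 0 ω‖ ^ 2 ∂P) (b := C) hη4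
  have hR0 : 0 < R := one_pos.trans_le hR1
  -- The deterministic constant with `c = c₀ / 2`, half of `c₀` being given up to centering; the `+
  -- 1` keeps it positive when `d = 0`.
  refine ⟨2 * d * √(2 * R / (c₀ / 2)) * (R + R * (d * R / (c₀ / 2))
    + R ^ 2 * (d * R / (c₀ / 2))) + 1, by positivity, ?_⟩
  obtain ⟨n₀, hn₀⟩ := exists_nat_ge (2 * R ^ 2 / (c₀ / 2))
  filter_upwards [hcoer, eventually_ge_atTop n₀, eventually_ge_atTop 2] with n hn hnn₀ hn2
  have hn0 : n ≠ 0 := by omega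
  have hnpos : (0 : ℝ) < n := by positivity
  have hnc : 2 * R ^ 2 ≤ n * (c₀ / 2) := by
    rw [← div_le_iff₀ (by positivity)]
    exact hn₀.trans (by exact_mod_cast hnn₀)
  set E₁ := {ω | R < ‖Y (n : ℤ) ω‖ ^ 2} with hE₁
  set E₂ := {ω | R < (n : ℝ)⁻¹ * ∑ k ∈ Finset.Icc 1 n, ‖Y (k : ℤ) ω‖ ^ 2} with hE₂
  set E₃ := {ω | R < (n : ℝ)⁻¹ * ‖∑ k ∈ Finset.Icc 1 n, Y (k : ℤ) ω‖ ^ 2} with hE₃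
  set E₄ := {ω | ¬ ∀ x ∈ V, c₀ * ‖x‖ ^ 2 ≤
    (n : ℝ)⁻¹ * ∑ k ∈ Finset.Icc 1 n, inner ℝ (Y (k : ℤ) ω) x ^ 2} with hE₄
  set E₅ := {ω | ¬ (Module.finrank ℝ V = d ∨ ∀ k : ℕ, y ω k ∈ V)} with hE₅
  have hP₁ : P E₁ ≤ ENNReal.ofReal (η / 4) := by
    refine measure_lt_le_ofReal (fun ω => sq_nonneg _)
      (integrable_norm_sq_of_memLp (hY.memLp _)) hR0 ?_
    rw [hY.integral_norm_sq]
    exact hRS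
  have hP₂ : P E₂ ≤ ENNReal.ofReal (η / 4) := by
    have hi : ∀ k : ℕ, Integrable (fun ω => ‖Y (k : ℤ) ω‖ ^ 2) P := fun k =>
      integrable_norm_sq_of_memLp (hY.memLp _)
    refine measure_lt_le_ofReal (fun ω => by positivity)
      ((integrable_finsetSum _ fun k _ => hi k).const_mul _) hR0 ?_
    rw [integral_const_mul, integral_finsetSum _ fun k _ => hi k]
    simp only [hY.integral_norm_sq]
    rw [Finset.sum_const, Nat.card_Icc, Nat.add_sub_cancel, nsmul_eq_mul,
      inv_mul_cancel_left₀ hnpos.ne']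
    exact hRS
  have hP₃ : P E₃ ≤ ENNReal.ofReal (η / 4) := by
    have hi : Integrable (fun ω => ‖∑ k ∈ Finset.Icc 1 n, Y (k : ℤ) ω‖ ^ 2) P :=
      integrable_norm_sq_of_memLp (memLp_finsetSum _ fun k _ => hY.memLp _)
    refine measure_lt_le_ofReal (fun ω => by positivity) (hi.const_mul _) hR0 ?_
    rw [integral_const_mul, inv_mul_le_iff₀ hnpos]
    refine (hC n (by omega)).trans ?_
    rw [mul_comm]
    gcongr
  have hP₅ : P E₅ = 0 := hdata
  have hsub : {ω | (2 * d * √(2 * R / (c₀ / 2)) * (R + R * (d * R / (c₀ / 2))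
      + R ^ 2 * (d * R / (c₀ / 2))) + 1) * (1 / (n : ℝ)) <
      |‖varPredictor (v n ω) (B n ω) n (y ω) - bosqPredictor (lam n ω) (v n ω) n (y ω)‖|} ⊆
      E₁ ∪ E₂ ∪ E₃ ∪ E₄ ∪ E₅ := by
    intro ω hω
    by_contra hcon
    simp only [hE₁, hE₂, hE₃, hE₄, hE₅, Set.mem_union, Set.mem_ofPred_eq, not_or, not_lt,
      not_not] at hcon
    obtain ⟨⟨⟨⟨h1, h2⟩, h3⟩, h4⟩, h5⟩ := hcon
    have h5' : Module.finrank ℝ V = d ∨ ∀ k : ℕ, y ω k ∈ V := by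
      by_contra h
      exact h5 (not_or.1 h)
    rw [Set.mem_ofPred_eq, abs_of_nonneg (norm_nonneg _)] at hω
    -- From `‖Y n‖ ^ 2 ≤ R ≤ R ^ 2`, which is why `R ≥ 1` was arranged.
    have hyn : ‖y ω n‖ ≤ R := by
      rw [hy]
      refine abs_le_of_sq_le_sq' ?_ hR0.le |>.2
      nlinarith
    have hmean : (n : ℝ) * ‖c n (y ω)‖ ^ 2 ≤ R := by
      refine le_trans ?_ h3
      have h6 := norm_le_norm_sampleMean (hm n ω)
      have h7 : ‖sampleMean n (y ω)‖ = (n : ℝ)⁻¹ * ‖∑ k ∈ Finset.Icc 1 n, Y (k : ℤ) ω‖ := by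
        rw [sampleMean, norm_smul, hyY, norm_inv, Real.norm_natCast]
      calc (n : ℝ) * ‖c n (y ω)‖ ^ 2 ≤
          n * ((n : ℝ)⁻¹ * ‖∑ k ∈ Finset.Icc 1 n, Y (k : ℤ) ω‖) ^ 2 := by
            rw [← h7]
            gcongr
        _ = _ := by field_simp
    have hmc : ‖c n (y ω)‖ ^ 2 ≤ c₀ / 2 := by
      refine le_of_mul_le_mul_left (hmean.trans ?_) hnpos
      nlinarith
    have hsum : (n : ℝ)⁻¹ * ∑ k ∈ Finset.Icc 1 n, ‖y ω k‖ ^ 2 ≤ R := by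
      rw [hyY]
      exact h2
    have hlow : ∀ x ∈ V, c₀ / 2 * ‖x‖ ^ 2 ≤ inner ℝ (empCov (c n (y ω)) n (y ω) x) x :=
      fun x hx => le_inner_empCov hn0 (hm n ω) (by rw [hyY]; exact h4 x hx) hmc
    have hdich : ∀ i, c₀ / 2 ≤ lam n ω i ∨
        ∀ k ∈ Finset.Icc 1 n, inner ℝ (y ω k) (v n ω i) = 0 := by
      intro i
      rcases h5' with h5 | h5
      · exact Or.inl ((hv n ω).le_eigenvalue V h5 hlow i)
      · exact le_eigenvalue_or_inner_eq_zero (hm n ω) V (fun k _ => h5 k) (by positivity) hlow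
          ((hv n ω).orthonormal.1 i) ((hv n ω).eigen i)
    have hmain := norm_varPredictor_sub_bosqPredictor_le hn2 (hm n ω) (hv n ω).orthonormal
      (hv n ω).eigen (hB n ω) (half_pos hc₀) hR0.le hdich hyn hmean hsum hnc
    have hinv : 0 < 1 / (n : ℝ) := by positivity
    rw [add_mul] at hω
    linarith
  calc _ ≤ P (E₁ ∪ E₂ ∪ E₃ ∪ E₄ ∪ E₅) := measure_mono hsub
    _ ≤ ENNReal.ofReal (η / 4) + ENNReal.ofReal (η / 4) + ENNReal.ofReal (η / 4)
        + ENNReal.ofReal (η / 4) + 0 := by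
      refine (measure_union_le _ _).trans (add_le_add ?_ hP₅.le)
      refine (measure_union_le _ _).trans (add_le_add ?_ hn)
      refine (measure_union_le _ _).trans (add_le_add ?_ hP₃)
      exact (measure_union_le _ _).trans (add_le_add hP₁ hP₂)
    _ = ENNReal.ofReal η := by
      rw [add_zero, ← ENNReal.ofReal_add hη4.le hη4.le, ← ENNReal.ofReal_add (by positivity) hη4.le,
        ← ENNReal.ofReal_add (by positivity) hη4.le]
      congr 1
      ring

end Conclusion

end FAR

theorem mainTheorem1 {Ω : Type*} [MeasurableSpace Ω] (P : Measure Ω) [IsProbabilityMeasure P]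
    [MeasurableSpace FAR.L2I] [BorelSpace FAR.L2I]
    (Ψ : FAR.L2I →L[ℝ] FAR.L2I) (ε Y : ℤ → Ω → FAR.L2I) (hY : FAR.IsFAR1 P Ψ ε Y)
    -- the observed sample path
    (y : Ω → ℕ → FAR.L2I) (hy : ∀ ω k, y ω k = Y (k : ℤ) ω)
    -- centering of the empirical covariance: at the sample mean, or at the true mean zero
    (c : ℕ → (ℕ → FAR.L2I) → FAR.L2I) (hc : c = FAR.sampleMean ∨ c = 0)
    -- any choice of the first `d` empirical eigenvalues and eigenfunctions
    (d : ℕ) (lam : ℕ → Ω → Fin d → ℝ) (v : ℕ → Ω → Fin d → FAR.L2I)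
    (hv : ∀ n ω, FAR.IsTopEigensystem (FAR.empCov (c n (y ω)) n (y ω)) (lam n ω) (v n ω))
    -- any least squares fit of a VAR(1) model to the empirical score vectors
    (B : ℕ → Ω → Matrix (Fin d) (Fin d) ℝ)
    (hB : ∀ n ω, FAR.IsOLS n (fun k => FAR.scores (v n ω) (y ω k)) (B n ω)) :
    FAR.IsBigOP P
      (fun n ω => ‖FAR.varPredictor (v n ω) (B n ω) n (y ω)
        - FAR.bosqPredictor (lam n ω) (v n ω) n (y ω)‖)
      (fun n => 1 / (n : ℝ)) := by
  -- Lets instance search find that `L²([0,1])` is second countable.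
  have : Fact ((2 : ENNReal) ≠ ⊤) := ⟨ENNReal.ofNat_ne_top⟩
  exact hY.isBigOP_varPredictor_sub_bosqPredictor hy hc hv hB
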